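/- Consider one time slot of the multichannel random hello protocol with $M\ge 1$ resource blocks ($M\in\mathbb N$), transmission probability $0<\rho<1$ and SINR threshold $\xi>0$. A typical node sits at the origin of $\mathbb R^2$; the other nodes are located at the points $X_j$ of a homogeneous Poisson point process of density $\lambda>0$. Independently, each node (the typical one included) transmits with probability $\rho$ and receives otherwise, and each node $j$ picks one of the $M$ blocks uniformly. All links undergo Rayleigh fading (i.i.d. power gains $h_j\sim\mathrm{Exp}(1)$) and i.i.d. shadowing gains $\vartheta_j>0$, distributed as $\vartheta$ with $\mathbb E\{\vartheta^{2/\alpha}\}<\infty$; locations, modes, blocks, fading and shadowing are independent. With path loss exponent $\alpha=4$ and noise power (divided by the transmit power) $\sigma^2\ge 0$, the SINR of node $i$ at the typical node is $$\Xi_i=\frac{h_i\vartheta_i|X_i|^{-\alpha}}{\sum_{j} h_j\vartheta_j|X_j|^{-\alpha}+\sigma^2},$$ where the sum runs over the transmitting nodes $j\ne i$ that use the same block as $i$. Let $S$ be the number of nodes that the typical node discovers, i.e. the number of transmitting nodes $i$ with $\Xi_i>\xi$ if the typical node is receiving, and $S=0$ if it is transmitting. Put $\lambda^{(\vartheta)}=\lambda\,\mathbb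 E\{\vartheta^{2/\alpha}\}$ (the effective density). (a) If $\sigma^2=0$, then $\mathbb E\{S\}=\frac{2}{\pi}\frac{M(1-\rho)}{\sqrt{\xi}}$, for all $\lambda$ and all distributions of $\vartheta$. (b) If $\sigma^2>0$, then for fixed $M,\rho,\xi,\sigma^2$ the mean $\mathbb E\{S\}$ is a function $F(\lambda^{(\vartheta)})$ of the effective density alone, and $F$ is strictly increasing on $(0,\infty)$; in particular, for fixed $\lambda$, $\mathbb E\{S\}$ strictly increases with $\mathbb E\{\vartheta^{2/\alpha}\}$. Moreover $F(t)\to\frac{2}{\pi}\frac{M(1-\rho)}{\sqrt{\xi}}$ as $t\to\infty$, so that $\mathbb E\{S\}$ tends to its interference-limited value as $\mathbb E\{\vartheta^{2/\alpha}\}\to\infty$, and $F(t)<\frac{2}{\pi}\frac{M(1-\rho)}{\sqrt{\xi}}$ for all $t>0$, so that this value is a strict upper bound for $\mathbb E\{S\}$. -/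

import Mathlib

open MeasureTheory ProbabilityTheory Filter Topology
open scoped ENNReal NNReal

namespace PeerDiscovery

/-- The Euclidean plane. -/
abbrev Plane : Type := EuclideanSpace ℝ (Fin 2)

/-- The number of indices `j` with `X j ω ∈ B`. -/
noncomputable def pointCount {Ω E : Type*} (X : ℕ → Ω → E) (B : Set E) (ω : Ω) : ℝ≥0∞ :=
  ∑' j, B.indicator (fun _ => (1 : ℝ≥0∞)) (X j ω)

/-- The random points `X 0, X 1, …` (in an arbitrary enumeration) form a Poisson point process with
intensity measure `μ`: the number of points in a measurable set `B` of finite intensity is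
Poisson distributed with mean `μ B`, and the numbers of points in finitely many pairwise disjoint
such sets are independent. -/
structure IsPoissonPointProcess {Ω E : Type*} [MeasurableSpace Ω] [MeasurableSpace E]
    (X : ℕ → Ω → E) (μ : Measure E) (P : Measure Ω) : Prop where
  measurable : ∀ j, Measurable (X j)
  map_pointCount : ∀ B : Set E, MeasurableSet B → μ B < ∞ →
    P.map (pointCount X B) =
      (poissonMeasure (μ B).toNNReal).map (fun k : ℕ => (k : ℝ≥0∞))
  indep_pointCount : ∀ (n : ℕ) (B : Fin n → Set E), (∀ i, MeasurableSet (B i)) →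
    (∀ i, μ (B i) < ∞) → Pairwise (fun i j => Disjoint (B i) (B j)) →
    iIndepFun (fun i => pointCount X (B i)) P

/-- The law of the mode of a node: `true` (transmitting) with probability `ρ`, and
`false` (receiving) with probability `1 - ρ`. -/
noncomputable def modeLaw (ρ : ℝ) : Measure Bool :=
  ENNReal.ofReal ρ • Measure.dirac true + ENNReal.ofReal (1 - ρ) • Measure.dirac false

/-- The joint law of the mode, the resource block, the fading power gain and the shadowing gain of
one node: these are independent, the resource block is uniform among the `M` blocks, the fading
is Rayleigh (so the power gain is exponential with mean one), and the shadowing has law `ν`. -/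
noncomputable def markLaw (M : ℕ) (ρ : ℝ) (ν : Measure ℝ) :
    Measure (Bool × Fin M × ℝ × ℝ) :=
  (modeLaw ρ).prod ((uniformOn Set.univ).prod ((expMeasure 1).prod ν))

/-- One time slot of the multichannel random hello protocol with `M` resource blocks and
transmission probability `ρ`, observed by a typical node at the origin; the other nodes form a
homogeneous Poisson point process of density `lam`, and all links undergo Rayleigh fading and
i.i.d. shadowing of law `ν`. -/
structure HelloSlot {Ω : Type*} [MeasurableSpace Ω] (P : Measure Ω)
    (M : ℕ) (lam ρ : ℝ) (ν : Measure ℝ) where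
  /-- location of node `j` -/
  pos : ℕ → Ω → Plane
  /-- whether the typical node transmits -/
  transmits₀ : Ω → Bool
  /-- whether node `j` transmits -/
  transmits : ℕ → Ω → Bool
  /-- the resource block chosen by node `j` -/
  block : ℕ → Ω → Fin M
  /-- fading power gain of the link from node `j` to the typical node -/
  fading : ℕ → Ω → ℝ
  /-- shadowing gain of the link from node `j` to the typical node -/
  shadowing : ℕ → Ω → ℝ
  isPoisson : IsPoissonPointProcess pos (ENNReal.ofReal lam • (volume : Measure Plane)) P
  measurable_transmits₀ : Measurable transmits₀
  measurable_transmits : ∀ j, Measurable (transmits j)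
  measurable_block : ∀ j, Measurable (block j)
  measurable_fading : ∀ j, Measurable (fading j)
  measurable_shadowing : ∀ j, Measurable (shadowing j)
  /-- The locations, the mode of the typical node and the marks of the other nodes are
  independent, and the marks are i.i.d. -/
  map_eq : P.map (fun ω => ((fun j => pos j ω), transmits₀ ω,
      fun j => (transmits j ω, block j ω, fading j ω, shadowing j ω))) =
    (P.map (fun ω j => pos j ω)).prod
      ((modeLaw ρ).prod (Measure.infinitePi (fun _ : ℕ => markLaw M ρ ν)))

namespace HelloSlot

variable {Ω : Type*} [MeasurableSpace Ω] {P : Measure Ω} {M : ℕ} {lam ρ : ℝ} {ν : Measure ℝ}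

/-- The power (relative to the common transmit power) received at the origin from node `j` when
it transmits, with path loss exponent `α`: fading gain times shadowing gain times `|X_j| ^ (-α)`. -/
noncomputable def receivedPower (s : HelloSlot P M lam ρ ν) (α : ℝ) (j : ℕ) (ω : Ω) : ℝ≥0∞ :=
  ENNReal.ofReal (s.fading j ω * s.shadowing j ω) * ENNReal.ofReal ‖s.pos j ω‖ ^ (-α)

open Classical in
/-- The interference to the packet of node `i`: the total power received from the other nodes that
transmit over the same resource block. -/
noncomputable def interference (s : HelloSlot P M lam ρ ν) (α : ℝ) (i : ℕ) (ω : Ω) : ℝ≥0∞ :=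
  ∑' j, if j ≠ i ∧ s.transmits j ω = true ∧ s.block j ω = s.block i ω
    then s.receivedPower α j ω else 0

/-- The SINR of the packet of node `i` at the typical node; `noise` is the noise power divided by
the transmit power. -/
noncomputable def sinr (s : HelloSlot P M lam ρ ν) (α noise : ℝ) (i : ℕ) (ω : Ω) : ℝ≥0∞ :=
  s.receivedPower α i ω / (s.interference α i ω + ENNReal.ofReal noise)

/-- The nodes that the typical node successfully discovers: the typical node is receiving, the
other node is transmitting, and its packet has an SINR above `ξ`. -/
def discovered (s : HelloSlot P M lam ρ ν) (α noise ξ : ℝ) (ω : Ω) : Set ℕ :=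
  {i | s.transmits₀ ω = false ∧ s.transmits i ω = true ∧
    ENNReal.ofReal ξ < s.sinr α noise i ω}

/-- The average number of nodes that the typical node successfully discovers. -/
noncomputable def meanDiscovered (s : HelloSlot P M lam ρ ν) (α noise ξ : ℝ) : ℝ≥0∞ :=
  ∫⁻ ω, ((s.discovered α noise ξ ω).encard : ℝ≥0∞) ∂P

end HelloSlot

/-- The effective node density under shadowing of law `ν`: the density `lam` times the moment
of order `2 / α` of the shadowing. -/
noncomputable def effectiveDensity (α lam : ℝ) (ν : Measure ℝ) : ℝ :=
  lam * ∫ t, t ^ (2 / α) ∂ν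

end PeerDiscovery

/-! Fix the locations. A packet from a transmitter at `x` with shadowing gain `t` is decoded when
its exponential fading gain exceeds `s * (I + σ²)`, where `s = ξ‖x‖⁴/t`; given the interference `I`
this has probability `exp (-s * (I + σ²))`. Averaging over the independent marks of the other nodes
turns `exp (-s * I)` into a product over `j ≠ i` of factors `1 - disturbance s (X j)`, that is, into
the exponential of a sum over the Poisson points other than `i`.

The Mecke formula (`lintegral_mecke`) replaces the sum over `i` by an integral over `x`, with the
remaining points still Poisson, and the Laplace functional gives `exp (-λ ∫ disturbance)`. Both are
derived from the counts alone: the Laplace functional by approximation with simple functions,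
Campbell's weighted formula by differentiating that functional, and the removal of point `i` by
dividing out its factor.

For path loss exponent four the planar integral is an arctangent integral, and the exponent becomes
`T * (ρ/M) * (π²/2) * √s`, with `T` the effective density (`lintegral_disturbance`). In the variable
`u = ‖x‖²`, `√s` is linear in `u`; the substitution `u = (√t/T) v` clears `t` and `T` from the
interference term, leaves `σ²ξv²/T²` as noise term, and produces a Jacobian whose shadowing mean
cancels `T`. Hence `E S = ρ(1-ρ)π ∫₀^∞ exp (-(σ²ξv²/T² + (ρ/M)(π²/2)√ξ v)) dv`, which is
`discoveryFunction`. Without noise it is an elementary exponential integral; with noise the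
integrand strictly increases with `T` towards the noise-free one.

Working in `[0, ∞]` throughout, with `exp (-∞) = 0`, avoids all summability questions about the
interference. -/

namespace PeerDiscovery

/-! ### The function `exp (-c)` on the extended nonnegative reals -/

/-- The function `c ↦ exp (-c)` on `[0, ∞]`, with `exp (-∞) = 0`. -/
noncomputable def expNeg (c : ℝ≥0∞) : ℝ≥0∞ := EReal.exp (-(c : EReal))

@[simp] lemma expNeg_zero : expNeg 0 = 1 := by simp [expNeg]

@[simp] lemma expNeg_top : expNeg ∞ = 0 := by simp [expNeg]

lemma expNeg_ofReal {x : ℝ} (hx : 0 ≤ x) :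
    expNeg (ENNReal.ofReal x) = ENNReal.ofReal (Real.exp (-x)) := by
  rw [expNeg, EReal.coe_ennreal_ofReal, max_eq_left hx, ← EReal.coe_neg, EReal.exp_coe]

lemma expNeg_add (a b : ℝ≥0∞) : expNeg (a + b) = expNeg a * expNeg b := by
  rw [expNeg, EReal.coe_ennreal_add, EReal.neg_add (by simp) (by simp), sub_eq_add_neg,
    EReal.exp_add]
  rfl

lemma expNeg_antitone : Antitone expNeg := fun _ _ h =>
  EReal.exp_monotone (EReal.neg_le_neg_iff.2 (EReal.coe_ennreal_le_coe_ennreal_iff.2 h))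

lemma expNeg_le_one (c : ℝ≥0∞) : expNeg c ≤ 1 := by
  simpa using expNeg_antitone (bot_le : 0 ≤ c)

lemma expNeg_ne_top (c : ℝ≥0∞) : expNeg c ≠ ∞ :=
  ((expNeg_le_one c).trans_lt ENNReal.one_lt_top).ne

lemma expNeg_eq_zero_iff {c : ℝ≥0∞} : expNeg c = 0 ↔ c = ∞ := by
  simp [expNeg]

lemma continuous_expNeg : Continuous expNeg :=
  ENNReal.continuous_exp.comp (continuous_neg.comp continuous_coe_ennreal_ereal)

lemma measurable_expNeg : Measurable expNeg := continuous_expNeg.measurable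

/-- Continuity together with antitonicity. Increasing approximations inside the exponential become
decreasing ones outside, so later limit passages need a finite dominating integral. -/
lemma expNeg_iSup {ι : Type*} [Nonempty ι] (f : ι → ℝ≥0∞) :
    expNeg (⨆ n, f n) = ⨅ n, expNeg (f n) :=
  expNeg_antitone.map_ciSup_of_continuousAt continuous_expNeg.continuousAt (OrderTop.bddAbove _)

lemma expNeg_sum {ι : Type*} (s : Finset ι) (f : ι → ℝ≥0∞) :
    expNeg (∑ i ∈ s, f i) = ∏ i ∈ s, expNeg (f i) := by
  classical
  induction s using Finset.induction_on with
  | empty => simp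
  | insert a s ha ih => rw [Finset.sum_insert ha, Finset.prod_insert ha, expNeg_add, ih]

lemma expNeg_natCast_mul (n : ℕ) (c : ℝ≥0∞) : expNeg (n * c) = expNeg c ^ n := by
  simpa using expNeg_sum (Finset.range n) (fun _ => c)

lemma expNeg_tsum (f : ℕ → ℝ≥0∞) :
    expNeg (∑' j, f j) = ⨅ n, ∏ j ∈ Finset.range n, expNeg (f j) := by
  rw [ENNReal.tsum_eq_iSup_nat, expNeg_iSup]
  simp_rw [expNeg_sum]

/-- The function `g ↦ -log g` on `[0, 1]`, the inverse of `expNeg`. -/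
noncomputable def negLog (g : ℝ≥0∞) : ℝ≥0∞ := (-ENNReal.log g).toENNReal

lemma expNeg_negLog {g : ℝ≥0∞} (hg : g ≤ 1) : expNeg (negLog g) = g := by
  rw [expNeg, negLog, EReal.coe_toENNReal, neg_neg, ENNReal.exp_log]
  rw [EReal.le_neg]
  simpa using hg

lemma negLog_antitone : Antitone negLog := fun a b h => by
  unfold negLog
  apply EReal.toENNReal_le_toENNReal
  exact EReal.neg_le_neg_iff.2 (ENNReal.log_monotone h)

lemma measurable_negLog : Measurable negLog := by
  unfold negLog
  fun_prop

lemma negLog_ne_top {g : ℝ≥0∞} (hg : g ≠ 0) : negLog g ≠ ∞ := by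
  simp [negLog, hg]

lemma expNeg_injective : Function.Injective expNeg := fun a b h => by
  have := ENNReal.logOrderIso.symm.injective h
  simpa using this

lemma one_sub_expNeg_le (c : ℝ≥0∞) : 1 - expNeg c ≤ c := by
  induction c with
  | top => simp
  | coe c =>
    rw [tsub_le_iff_right, ← ENNReal.ofReal_coe_nnreal, expNeg_ofReal c.coe_nonneg,
      ← ENNReal.ofReal_add c.coe_nonneg (Real.exp_pos _).le]
    apply ENNReal.one_le_ofReal.2
    have := Real.add_one_le_exp (-(c : ℝ))
    linarith

/-- With `q = exp (-c / 2^(k+1))` the claim is `1 - q² ≤ 2(1 - q)`, i.e. `(1 - q)² ≥ 0`. Along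
dyadic steps the difference quotient of `exp` at zero is thus monotone, and derivatives can be taken
by monotone convergence. -/
lemma monotone_two_pow_mul_one_sub_expNeg (c : ℝ≥0∞) :
    Monotone fun k : ℕ => 2 ^ k * (1 - expNeg (c / 2 ^ k)) := by
  refine monotone_nat_of_le_succ fun k => ?_
  have h2 : c / 2 ^ k = c / 2 ^ (k + 1) + c / 2 ^ (k + 1) := by
    rw [← ENNReal.add_div, ← mul_two, pow_succ, ENNReal.mul_div_mul_right _ _ (by simp) (by simp)]
  rw [h2, expNeg_add, pow_succ (2 : ℝ≥0∞) k, mul_assoc]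
  gcongr
  have hq := expNeg_le_one (c / (2 ^ k * 2))
  have hq_top := expNeg_ne_top (c / (2 ^ k * 2))
  generalize expNeg (c / (2 ^ k * 2)) = q at hq hq_top
  rw [tsub_le_iff_right]
  lift q to ℝ≥0 using hq_top
  have hq' : q ≤ 1 := by exact_mod_cast hq
  have h : (1 : ℝ≥0) ≤ 2 * (1 - q) + q * q := by
    rw [← NNReal.coe_le_coe]
    push_cast [NNReal.coe_sub hq']
    nlinarith [sq_nonneg (1 - (q : ℝ))]
  exact_mod_cast h

lemma tendsto_two_pow_mul_one_sub_expNeg (c : ℝ≥0) :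
    Tendsto (fun k : ℕ => (2 : ℝ≥0∞) ^ k * (1 - expNeg (c / 2 ^ k))) atTop (𝓝 c) := by
  have hd : HasDerivAt (fun x : ℝ => 1 - Real.exp (-x)) 1 0 := by
    have := ((hasDerivAt_neg (0 : ℝ)).exp).const_sub 1
    simpa using this
  have h0 : Tendsto (fun k : ℕ => (c : ℝ) / 2 ^ k) atTop (𝓝 0) := by
    simpa [div_eq_mul_inv] using
      (tendsto_pow_atTop_nhds_zero_of_lt_one (r := (2 : ℝ)⁻¹) (by norm_num)
        (by norm_num)).const_mul (c : ℝ)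
  have key : Tendsto (fun k : ℕ => (2 : ℝ) ^ k * (1 - Real.exp (-((c : ℝ) / 2 ^ k))))
      atTop (𝓝 c) := by
    by_cases hc : c = 0
    · simp [hc]
    have hc' : (0 : ℝ) < c := by positivity
    have hs := hasDerivAt_iff_tendsto_slope.1 hd
    have h1 : Tendsto (fun k : ℕ => (c : ℝ) / 2 ^ k) atTop (𝓝[≠] 0) :=
      tendsto_nhdsWithin_iff.2 ⟨h0, .of_forall fun k => by
        have : (0 : ℝ) < c / 2 ^ k := by positivity
        exact this.ne'⟩
    have h3 := (hs.comp h1).const_mul (c : ℝ)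
    rw [mul_one] at h3
    refine h3.congr fun k => ?_
    simp only [Function.comp, slope, sub_zero, vsub_eq_sub, smul_eq_mul, neg_zero, Real.exp_zero,
      sub_self]
    field_simp
  have := ENNReal.tendsto_ofReal key
  rw [ENNReal.ofReal_coe_nnreal] at this
  refine this.congr fun k => ?_
  have hk : (c : ℝ≥0∞) / 2 ^ k = ENNReal.ofReal ((c : ℝ) / 2 ^ k) := by
    rw [ENNReal.ofReal_div_of_pos (by positivity), ENNReal.ofReal_coe_nnreal,
      ENNReal.ofReal_pow (by norm_num)]
    simp
  rw [hk, expNeg_ofReal (by positivity), ENNReal.ofReal_mul (by positivity),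
    ENNReal.ofReal_pow (by norm_num), ENNReal.ofReal_sub _ (Real.exp_pos _).le]
  simp

lemma iSup_two_pow_mul_one_sub_expNeg (c : ℝ≥0∞) :
    ⨆ k : ℕ, 2 ^ k * (1 - expNeg (c / 2 ^ k)) = c := by
  induction c with
  | top =>
    have (k : ℕ) : (∞ : ℝ≥0∞) / 2 ^ k = ∞ := ENNReal.top_div_of_ne_top (by simp)
    simp only [this, expNeg_top, tsub_zero, mul_one]
    exact iSup_eq_of_tendsto (pow_right_mono₀ (by norm_num))
      (ENNReal.tendsto_pow_atTop_nhds_top_iff.2 (by norm_num))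
  | coe c =>
    exact iSup_eq_of_tendsto (monotone_two_pow_mul_one_sub_expNeg _)
      (tendsto_two_pow_mul_one_sub_expNeg c)

/-- If `a k ↦ 2 ^ k * a k` increases to `D`, then so does `2 ^ k * (1 - exp (-a k))`. -/
lemma iSup_two_pow_mul_one_sub_expNeg_of_monotone {a : ℕ → ℝ≥0∞}
    (ha : Monotone fun k : ℕ => 2 ^ k * a k) :
    ⨆ k : ℕ, 2 ^ k * (1 - expNeg (a k)) = ⨆ k : ℕ, 2 ^ k * a k := by
  apply le_antisymm
  · exact iSup_mono fun k => by gcongr; exact one_sub_expNeg_le _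
  · refine iSup_le fun m => ?_
    -- Freeze `c = 2^m * a m`. For `k ≥ m` the hypothesis gives `c / 2^k ≤ a k`, so each quotient
    -- for `c` is dominated by one for `a`.
    rw [← iSup_two_pow_mul_one_sub_expNeg (2 ^ m * a m)]
    refine iSup_le fun k => ?_
    refine (monotone_two_pow_mul_one_sub_expNeg _ (le_max_left k m)).trans ?_
    refine le_iSup_of_le (max k m) ?_
    refine mul_le_mul_right (tsub_le_tsub_left (expNeg_antitone ?_) _) _
    apply ENNReal.div_le_of_le_mul'
    exact ha (le_max_right k m)

/-! ### The Laplace functional of a Poisson point process -/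

lemma tsum_iSup_of_monotone {f : ℕ → ℕ → ℝ≥0∞} (hf : Monotone f) :
    ∑' j, ⨆ n, f n j = ⨆ n, ∑' j, f n j := by
  simp_rw [← lintegral_count]
  exact lintegral_iSup (fun n => measurable_from_top) hf

/-- The generating function `E q^N = exp (-r(1 - q))` at `q = exp (-c)`; `c = ∞` is covered, with `q
= 0` and `0^0 = 1`. -/
lemma lintegral_expNeg_poissonMeasure (r : ℝ≥0) (c : ℝ≥0∞) :
    ∫⁻ n : ℕ, expNeg (c * n) ∂(poissonMeasure r) = expNeg (r * (1 - expNeg c)) := by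
  have hq := expNeg_le_one c
  have hq_top := expNeg_ne_top c
  simp_rw [mul_comm c, expNeg_natCast_mul]
  generalize expNeg c = q at hq hq_top
  lift q to ℝ≥0 using hq_top
  have hq' : q ≤ 1 := by exact_mod_cast hq
  have hs : HasSum (fun n : ℕ => Real.exp (-r) * r ^ n / (n.factorial : ℝ) * (q : ℝ) ^ n)
      (Real.exp (-(r * (1 - q : ℝ)))) := by
    convert! (NormedSpace.expSeries_div_hasSum_exp ((r : ℝ) * q)).mul_left (Real.exp (-r)) using 1
    · ext n; rw [mul_pow]; ring
    · rw [← Real.exp_eq_exp_ℝ, ← Real.exp_add]; ring_nf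
  have hc : (r : ℝ≥0∞) * (1 - q) = ENNReal.ofReal (r * (1 - q : ℝ)) := by
    rw [ENNReal.ofReal_mul r.coe_nonneg, ENNReal.ofReal_sub _ q.coe_nonneg]
    simp
  rw [hc, expNeg_ofReal (mul_nonneg r.coe_nonneg (sub_nonneg.2 (by exact_mod_cast hq'))),
    ← hs.tsum_eq, ENNReal.ofReal_tsum_of_nonneg (fun n => by positivity) hs.summable,
    poissonMeasure, lintegral_sum_measure]
  refine tsum_congr fun n => ?_
  rw [lintegral_smul_measure, lintegral_dirac, smul_eq_mul, ENNReal.ofReal_mul (by positivity),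
    ENNReal.ofReal_pow q.coe_nonneg, ENNReal.ofReal_coe_nnreal]

section PointProcess

variable {Ω E : Type*} [MeasurableSpace Ω] [MeasurableSpace E] {X : ℕ → Ω → E} {μ : Measure E}
  {P : Measure Ω}

lemma measurable_pointCount (hX : ∀ j, Measurable (X j)) {B : Set E} (hB : MeasurableSet B) :
    Measurable (pointCount X B) := by
  unfold pointCount
  exact Measurable.tsum fun j => (measurable_const.indicator hB).comp (hX j)

lemma IsPoissonPointProcess.lintegral_expNeg_pointCount (hX : IsPoissonPointProcess X μ P)
    {B : Set E} (hB : MeasurableSet B) (hμB : μ B < ∞) (c : ℝ≥0∞) :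
    ∫⁻ ω, expNeg (c * pointCount X B ω) ∂P = expNeg (μ B * (1 - expNeg c)) := by
  have hm : Measurable fun x : ℝ≥0∞ => expNeg (c * x) :=
    measurable_expNeg.comp (measurable_const_mul c)
  rw [← lintegral_map (f := fun x => expNeg (c * x)) hm (measurable_pointCount hX.measurable hB),
    hX.map_pointCount B hB hμB, lintegral_map hm measurable_from_top,
    lintegral_expNeg_poissonMeasure, ENNReal.coe_toNNReal hμB.ne]

lemma IsPoissonPointProcess.lintegral_expNeg_sum_pointCount (hX : IsPoissonPointProcess X μ P)
    {n : ℕ} {B : Fin n → Set E} (hB : ∀ i, MeasurableSet (B i)) (hμB : ∀ i, μ (B i) < ∞)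
    (hd : Pairwise fun i j => Disjoint (B i) (B j)) (c : Fin n → ℝ≥0∞) :
    ∫⁻ ω, expNeg (∑ i, c i * pointCount X (B i) ω) ∂P =
      expNeg (∑ i, μ (B i) * (1 - expNeg (c i))) := by
  simp_rw [expNeg_sum]
  have hm (i : Fin n) : Measurable fun x : ℝ≥0∞ => expNeg (c i * x) :=
    measurable_expNeg.comp (measurable_const_mul (c i))
  have hi := (hX.indep_pointCount n B hB hμB hd).comp _ hm
  refine (lintegral_prod_eq_prod_lintegral_of_indepFun Finset.univ _ hi fun i =>
    (hm i).comp (measurable_pointCount hX.measurable (hB i))).trans ?_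
  exact Finset.prod_congr rfl fun i _ => hX.lintegral_expNeg_pointCount (hB i) (hμB i) (c i)

/-- The level sets are disjoint, so the sum over points is a linear combination of independent
Poisson counts. -/
lemma IsPoissonPointProcess.lintegral_expNeg_simpleFunc (hX : IsPoissonPointProcess X μ P)
    (g : SimpleFunc E ℝ≥0∞) (hg : μ (Function.support g) < ∞) :
    ∫⁻ ω, expNeg (∑' j, g (X j ω)) ∂P = expNeg (∫⁻ y, (1 - expNeg (g y)) ∂μ) := by
  classical
  -- The zero level set may have infinite intensity, but contributes nothing to either side.
  set s := g.range.filter (· ≠ 0)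
  let e := s.equivFin
  let c : Fin s.card → ℝ≥0∞ := fun i => (e.symm i : ℝ≥0∞)
  have hsum (φ : ℝ≥0∞ → ℝ≥0∞) : ∑ i, φ (c i) = ∑ a ∈ s, φ a := by
    rw [← Finset.sum_coe_sort s φ]
    exact e.symm.sum_comp fun a : s => φ a
  have hB (i : Fin s.card) : MeasurableSet (g ⁻¹' {c i}) := g.measurableSet_preimage _
  have hμB (i : Fin s.card) : μ (g ⁻¹' {c i}) < ∞ := by
    refine (measure_mono fun x hx => ?_).trans_lt hg
    have h0 : (c i) ≠ 0 := (Finset.mem_filter.1 (e.symm i).2).2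
    rw [Set.mem_preimage, Set.mem_singleton_iff] at hx
    rwa [Function.mem_support, hx]
  have hd : Pairwise fun i j => Disjoint (g ⁻¹' {c i}) (g ⁻¹' {c j}) := fun i j hij => by
    refine Disjoint.preimage _ (Set.disjoint_singleton.2 fun h => hij ?_)
    exact e.symm.injective (Subtype.ext h)
  have h := hX.lintegral_expNeg_sum_pointCount hB hμB hd c
  rw [hsum (fun a => μ (g ⁻¹' {a}) * (1 - expNeg a))] at h
  have hpt (x : E) : g x = ∑ a ∈ s, a * (g ⁻¹' {a}).indicator (fun _ => 1) x := by
    by_cases hx : g x = 0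
    · rw [hx, Finset.sum_eq_zero]
      intro a ha
      rw [Set.indicator_of_notMem, mul_zero]
      intro hxa
      exact (Finset.mem_filter.1 ha).2 (hx ▸ (Set.mem_singleton_iff.1 hxa).symm)
    · rw [Finset.sum_eq_single (g x)]
      · simp
      · intro a _ hne
        rw [Set.indicator_of_notMem, mul_zero]
        exact fun hxa => hne (Set.mem_singleton_iff.1 hxa).symm
      · exact fun hn => (hn (Finset.mem_filter.2 ⟨g.mem_range_self x, hx⟩)).elim
  have hleft (ω : Ω) : ∑' j, g (X j ω) = ∑ i, c i * pointCount X (g ⁻¹' {c i}) ω := by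
    rw [hsum (fun a => a * pointCount X (g ⁻¹' {a}) ω)]
    simp_rw [pointCount, ← ENNReal.tsum_mul_left]
    rw [← Summable.tsum_finsetSum fun _ _ => ENNReal.summable]
    exact tsum_congr fun j => hpt _
  have hright : ∫⁻ y, (1 - expNeg (g y)) ∂μ = ∑ a ∈ s, μ (g ⁻¹' {a}) * (1 - expNeg a) := by
    have := SimpleFunc.map_lintegral (μ := μ) (fun a => 1 - expNeg a) g
    rw [← SimpleFunc.lintegral_eq_lintegral] at this
    simp only [SimpleFunc.map_apply] at this
    rw [this, Finset.sum_filter]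
    refine Finset.sum_congr rfl fun a _ => ?_
    by_cases ha : a = 0
    · simp [ha]
    · simp [ha, mul_comm]
  simp_rw [hleft]
  rw [h, hright]

/-- The Laplace functional of a Poisson point process. -/
theorem IsPoissonPointProcess.lintegral_expNeg_tsum [IsProbabilityMeasure P] [SigmaFinite μ]
    (hX : IsPoissonPointProcess X μ P) {f : E → ℝ≥0∞} (hf : Measurable f) :
    ∫⁻ ω, expNeg (∑' j, f (X j ω)) ∂P = expNeg (∫⁻ y, (1 - expNeg (f y)) ∂μ) := by
  -- The restriction gives the approximants supports of finite intensity while they still increase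
  -- to `f`.
  let g : ℕ → SimpleFunc E ℝ≥0∞ := fun n => (SimpleFunc.eapprox f n).restrict (spanningSets μ n)
  have hg (n : ℕ) (x : E) :
      g n x = (spanningSets μ n).indicator (SimpleFunc.eapprox f n) x :=
    SimpleFunc.restrict_apply _ (measurableSet_spanningSets μ n) x
  have hmono (x : E) : Monotone fun n => g n x := fun m n hmn => by
    simp only [hg]
    refine (Set.indicator_le_indicator (SimpleFunc.monotone_eapprox f hmn x)).trans ?_
    exact Set.indicator_le_indicator_of_subset (monotone_spanningSets μ hmn)
      (fun _ => bot_le) x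
  have hsup (x : E) : ⨆ n, g n x = f x := by
    apply le_antisymm
    · refine iSup_le fun n => ?_
      rw [hg, ← SimpleFunc.iSup_eapprox_apply hf x]
      exact (Set.indicator_le_self _ _ x).trans (le_iSup (fun n => SimpleFunc.eapprox f n x) n)
    · rw [← SimpleFunc.iSup_eapprox_apply hf x]
      refine iSup_le fun n => ?_
      obtain ⟨m, hm⟩ : ∃ m, x ∈ spanningSets μ m := by
        rw [← Set.mem_iUnion, iUnion_spanningSets]
        exact Set.mem_univ x
      refine le_iSup_of_le (max n m) ?_
      rw [hg, Set.indicator_of_mem (monotone_spanningSets μ (le_max_right n m) hm)]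
      exact SimpleFunc.monotone_eapprox f (le_max_left n m) x
  have hsimple (n : ℕ) := hX.lintegral_expNeg_simpleFunc (g n) (by
    refine (measure_mono fun x hx => ?_).trans_lt (measure_spanningSets_lt_top μ n)
    rw [Function.mem_support, hg] at hx
    exact Set.mem_of_indicator_ne_zero hx)
  have hmeas (n : ℕ) : Measurable fun ω => expNeg (∑' j, g n (X j ω)) :=
    measurable_expNeg.comp (Measurable.tsum fun j => (g n).measurable.comp (hX.measurable j))
  calc ∫⁻ ω, expNeg (∑' j, f (X j ω)) ∂P
      = ∫⁻ ω, ⨅ n, expNeg (∑' j, g n (X j ω)) ∂P := by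
        refine lintegral_congr fun ω => ?_
        rw [← expNeg_iSup, ← tsum_iSup_of_monotone fun m n hmn j => hmono (X j ω) hmn]
        simp_rw [hsup]
    _ = ⨅ n, ∫⁻ ω, expNeg (∑' j, g n (X j ω)) ∂P := by
        refine lintegral_iInf hmeas (fun m n hmn ω => ?_) ?_
        · exact expNeg_antitone (ENNReal.tsum_le_tsum fun j => hmono (X j ω) hmn)
        · refine ((lintegral_mono fun ω => expNeg_le_one _).trans_lt ?_).ne
          simp
    _ = ⨅ n, expNeg (∫⁻ y, (1 - expNeg (g n y)) ∂μ) := by simp_rw [hsimple]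
    _ = expNeg (∫⁻ y, (1 - expNeg (f y)) ∂μ) := by
        rw [← expNeg_iSup, ← lintegral_iSup]
        · simp_rw [← ENNReal.sub_iInf, ← expNeg_iSup, hsup]
        · exact fun n => (measurable_expNeg.comp (g n).measurable).const_sub 1
        · exact fun m n hmn x => tsub_le_tsub_left (expNeg_antitone (hmono x hmn)) 1

/-- Campbell's formula, weighted by the exponential of a linear statistic. -/
theorem IsPoissonPointProcess.lintegral_tsum_mul_expNeg_tsum [IsProbabilityMeasure P]
    [SigmaFinite μ] (hX : IsPoissonPointProcess X μ P) {v f : E → ℝ≥0∞} (hv : Measurable v)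
    (hf : Measurable f) :
    ∫⁻ ω, (∑' i, v (X i ω)) * expNeg (∑' j, f (X j ω)) ∂P =
      (∫⁻ x, v x * expNeg (f x) ∂μ) * expNeg (∫⁻ y, (1 - expNeg (f y)) ∂μ) := by
  set A := ∫⁻ y, (1 - expNeg (f y)) ∂μ
  -- The increment of the Laplace exponent when `f` is replaced by `f + v / 2^k`; its rescaled limit
  -- is the derivative in the direction `v`.
  let a : ℕ → ℝ≥0∞ := fun k => ∫⁻ y, expNeg (f y) * (1 - expNeg (v y / 2 ^ k)) ∂μ
  have hV : Measurable fun ω => ∑' i, v (X i ω) :=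
    Measurable.tsum fun i => hv.comp (hX.measurable i)
  have hW : Measurable fun ω => ∑' i, f (X i ω) :=
    Measurable.tsum fun i => hf.comp (hX.measurable i)
  have hvk (k : ℕ) : Measurable fun y => v y / 2 ^ k := hv.div_const _
  have hE (k : ℕ) : Measurable fun y => expNeg (f y) * (1 - expNeg (v y / 2 ^ k)) :=
    (measurable_expNeg.comp hf).mul ((measurable_expNeg.comp (hvk k)).const_sub 1)
  have ha_eq (k : ℕ) : 2 ^ k * a k =
      ∫⁻ y, expNeg (f y) * (2 ^ k * (1 - expNeg (v y / 2 ^ k))) ∂μ := by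
    rw [← lintegral_const_mul _ (hE k)]
    exact lintegral_congr fun y => by ring
  have ha_mono : Monotone fun k : ℕ => 2 ^ k * a k := fun m n hmn => by
    simp only [ha_eq]
    exact lintegral_mono fun y => by
      exact mul_le_mul_right (monotone_two_pow_mul_one_sub_expNeg _ hmn) _
  have ha_sup : ⨆ k, 2 ^ k * a k = ∫⁻ x, v x * expNeg (f x) ∂μ := by
    simp_rw [ha_eq]
    rw [← lintegral_iSup]
    · simp_rw [← ENNReal.mul_iSup, iSup_two_pow_mul_one_sub_expNeg, mul_comm]
    · exact fun k => (measurable_expNeg.comp hf).mul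
        (((measurable_expNeg.comp (hvk k)).const_sub 1).const_mul _)
    · exact fun m n hmn y => by
        dsimp only
        exact mul_le_mul_right (monotone_two_pow_mul_one_sub_expNeg _ hmn) _
  -- A difference of the Laplace functionals of `f` and `f + v / 2^k`; multiplied by `2^k`, it is
  -- the difference quotient whose supremum is sought.
  have hstep (k : ℕ) : ∫⁻ ω, expNeg (∑' j, f (X j ω)) *
      (1 - expNeg ((∑' i, v (X i ω)) / 2 ^ k)) ∂P = expNeg A * (1 - expNeg (a k)) := by
    have h1 (ω : Ω) : expNeg (∑' j, f (X j ω)) * (1 - expNeg ((∑' i, v (X i ω)) / 2 ^ k)) =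
        expNeg (∑' j, f (X j ω)) - expNeg (∑' j, (f (X j ω) + v (X j ω) / 2 ^ k)) := by
      rw [ENNReal.mul_sub fun _ _ => expNeg_ne_top _, mul_one, ← expNeg_add, ENNReal.tsum_add]
      simp_rw [div_eq_mul_inv, ENNReal.tsum_mul_right]
    have h2 : ∫⁻ y, (1 - expNeg (f y + v y / 2 ^ k)) ∂μ = A + a k := by
      rw [← lintegral_add_right _ (hE k)]
      refine lintegral_congr fun y => ?_
      rw [expNeg_add]
      have hp := expNeg_le_one (f y)
      have hq := expNeg_le_one (v y / 2 ^ k)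
      rw [ENNReal.mul_sub fun _ _ => expNeg_ne_top _, mul_one, tsub_add_tsub_cancel hp]
      exact mul_le_of_le_one_right bot_le hq
    have hfv : Measurable fun y => f y + v y / 2 ^ k := hf.add (hvk k)
    simp_rw [h1]
    rw [lintegral_sub, hX.lintegral_expNeg_tsum hf, hX.lintegral_expNeg_tsum hfv, h2, expNeg_add,
      ENNReal.mul_sub fun _ _ => expNeg_ne_top _, mul_one]
    · exact measurable_expNeg.comp
        (Measurable.tsum fun i => hfv.comp (hX.measurable i))
    · rw [hX.lintegral_expNeg_tsum hfv]
      exact expNeg_ne_top _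
    · exact .of_forall fun ω => expNeg_antitone
        (ENNReal.tsum_le_tsum fun j => le_self_add)
  have hm₀ (k : ℕ) : Measurable fun ω => expNeg (∑' j, f (X j ω)) *
      (1 - expNeg ((∑' i, v (X i ω)) / 2 ^ k)) :=
    (measurable_expNeg.comp hW).mul ((measurable_expNeg.comp (hV.div_const _)).const_sub 1)
  have hm (k : ℕ) : Measurable fun ω => 2 ^ k * (expNeg (∑' j, f (X j ω)) *
      (1 - expNeg ((∑' i, v (X i ω)) / 2 ^ k))) := (hm₀ k).const_mul _
  calc ∫⁻ ω, (∑' i, v (X i ω)) * expNeg (∑' j, f (X j ω)) ∂P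
      = ∫⁻ ω, ⨆ k : ℕ, 2 ^ k * (expNeg (∑' j, f (X j ω)) *
          (1 - expNeg ((∑' i, v (X i ω)) / 2 ^ k))) ∂P := by
        refine lintegral_congr fun ω => ?_
        simp_rw [mul_left_comm _ (expNeg (∑' j, f (X j ω)))]
        rw [← ENNReal.mul_iSup, iSup_two_pow_mul_one_sub_expNeg, mul_comm]
    _ = ⨆ k : ℕ, 2 ^ k * (expNeg A * (1 - expNeg (a k))) := by
        rw [lintegral_iSup hm]
        · refine iSup_congr fun k => ?_
          rw [lintegral_const_mul _ (hm₀ k), hstep]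
        · intro m n hmn ω
          simp only [mul_left_comm _ (expNeg (∑' j, f (X j ω)))]
          exact mul_le_mul_right (monotone_two_pow_mul_one_sub_expNeg _ hmn) _
    _ = _ := by
        simp_rw [mul_left_comm _ (expNeg A)]
        rw [← ENNReal.mul_iSup, iSup_two_pow_mul_one_sub_expNeg_of_monotone ha_mono, ha_sup,
          mul_comm]

end PointProcess

/-! ### The reduced Palm and Mecke formulas -/

section PointProcess

variable {Ω E : Type*} [MeasurableSpace Ω] [MeasurableSpace E] {X : ℕ → Ω → E} {μ : Measure E}
  {P : Measure Ω} [IsProbabilityMeasure P] [SigmaFinite μ]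

lemma IsPoissonPointProcess.lintegral_tsum (hX : IsPoissonPointProcess X μ P) {u : E → ℝ≥0∞}
    (hu : Measurable u) : ∫⁻ ω, ∑' i, u (X i ω) ∂P = ∫⁻ x, u x ∂μ := by
  simpa using hX.lintegral_tsum_mul_expNeg_tsum hu (f := 0) measurable_zero

/-- The mean number of points at `x` is `μ {x} = 0`. This keeps nodes away from the singularity of
the path loss at the origin. -/
lemma IsPoissonPointProcess.ae_ne [NullSingletonClass μ] [MeasurableSingletonClass E]
    (hX : IsPoissonPointProcess X μ P) (x : E) : ∀ᵐ ω ∂P, ∀ i, X i ω ≠ x := by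
  have hm : Measurable (Set.indicator {x} fun _ : E => (1 : ℝ≥0∞)) :=
    measurable_const.indicator (measurableSet_singleton x)
  have h := hX.lintegral_tsum hm
  have hm' : Measurable fun ω => ∑' i, Set.indicator {x} (fun _ : E => (1 : ℝ≥0∞)) (X i ω) :=
    Measurable.tsum fun i => hm.comp (hX.measurable i)
  rw [lintegral_indicator_const (measurableSet_singleton x), measure_singleton, mul_zero,
    lintegral_eq_zero_iff hm'] at h
  filter_upwards [h] with ω hω i hi
  have := ENNReal.tsum_eq_zero.1 hω i
  simp [hi] at this

/-- The sum of `f` over all points but the `i`-th one. -/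
lemma expNeg_tsum_ne {f : ℕ → ℝ≥0∞} {i : ℕ} (hf : f i ≠ ∞) :
    expNeg (∑' j, if j = i then 0 else f j) = (expNeg (f i))⁻¹ * expNeg (∑' j, f j) := by
  rw [ENNReal.tsum_eq_add_tsum_ite (f := f) i, expNeg_add, ← mul_assoc,
    ENNReal.inv_mul_cancel (expNeg_eq_zero_iff.not.2 hf) (expNeg_ne_top _), one_mul]
  congr!

/-- Dropping point `i` divides by `expNeg (f (X i))`. Campbell's formula with weight `u / expNeg f`
restores that factor, so the other points behave like the original process. Finiteness of `f` makes
the division legitimate. -/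
theorem IsPoissonPointProcess.lintegral_tsum_expNeg_tsum_ne
    (hX : IsPoissonPointProcess X μ P) {u f : E → ℝ≥0∞} (hu : Measurable u)
    (hf : Measurable f) (hf_top : ∀ x, f x ≠ ∞) :
    ∫⁻ ω, ∑' i, u (X i ω) * expNeg (∑' j, if j = i then 0 else f (X j ω)) ∂P =
      (∫⁻ x, u x ∂μ) * expNeg (∫⁻ y, (1 - expNeg (f y)) ∂μ) := by
  have h (ω : Ω) (i : ℕ) : expNeg (∑' j, if j = i then 0 else f (X j ω)) =
      (expNeg (f (X i ω)))⁻¹ * expNeg (∑' j, f (X j ω)) :=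
    expNeg_tsum_ne (f := fun j => f (X j ω)) (hf_top _)
  simp_rw [h, ← mul_assoc, ENNReal.tsum_mul_right]
  have hm : Measurable fun x => u x * (expNeg (f x))⁻¹ := hu.mul (measurable_expNeg.comp hf).inv
  rw [hX.lintegral_tsum_mul_expNeg_tsum hm hf]
  congr 1
  refine lintegral_congr fun x => ?_
  rw [mul_assoc, ENNReal.inv_mul_cancel (expNeg_eq_zero_iff.not.2 (hf_top x)) (expNeg_ne_top _),
    mul_one]

/-- The Mecke formula for exponentials of linear statistics that depend on the distinguished point
through a simple function. -/
lemma IsPoissonPointProcess.lintegral_mecke_simpleFunc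
    (hX : IsPoissonPointProcess X μ P) {u : E → ℝ≥0∞} (hu : Measurable u)
    {f : ℝ≥0∞ → E → ℝ≥0∞} (hf : ∀ s, Measurable (f s)) (hf_top : ∀ s x, f s x ≠ ∞)
    (q : SimpleFunc E ℝ≥0∞) :
    ∫⁻ ω, ∑' i, u (X i ω) * expNeg (∑' j, if j = i then 0 else f (q (X i ω)) (X j ω)) ∂P =
      ∫⁻ x, u x * expNeg (∫⁻ y, (1 - expNeg (f (q x) y)) ∂μ) ∂μ := by
  -- Splitting `u` over the level sets of `q` freezes the parameter of `f`, which reduces the claim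
  -- to a fixed `f`.
  have hind (φ : ℝ≥0∞ → ℝ≥0∞) (x : E) : u x * φ (q x) =
      ∑ a ∈ q.range, (q ⁻¹' {a}).indicator u x * φ a := by
    rw [Finset.sum_eq_single (q x)]
    · simp
    · intro a _ hne
      rw [Set.indicator_of_notMem, zero_mul]
      exact fun hxa => hne (Set.mem_singleton_iff.1 hxa).symm
    · exact fun hn => (hn (q.mem_range_self x)).elim
  have hua (a : ℝ≥0∞) : Measurable ((q ⁻¹' {a}).indicator u) :=
    hu.indicator (q.measurableSet_preimage _)
  have h1 (ω : Ω) (i : ℕ) := hind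
    (fun a => expNeg (∑' j, if j = i then 0 else f a (X j ω))) (X i ω)
  have h2 (x : E) := hind (fun a => expNeg (∫⁻ y, (1 - expNeg (f a y)) ∂μ)) x
  simp_rw [h1, h2]
  rw [lintegral_finsetSum _ fun a _ => (hua a).mul_const _]
  simp_rw [Summable.tsum_finsetSum fun _ _ => ENNReal.summable]
  rw [lintegral_finsetSum]
  · refine Finset.sum_congr rfl fun a _ => ?_
    rw [hX.lintegral_tsum_expNeg_tsum_ne (hua a) (hf a) (hf_top a),
      lintegral_mul_const _ (hua a)]
  · refine fun a _ => Measurable.tsum fun i => ((hua a).comp (hX.measurable i)).mul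
      (measurable_expNeg.comp (Measurable.tsum fun j => ?_))
    split_ifs
    · exact measurable_const
    · exact (hf a).comp (hX.measurable j)

/-- Simple functions increasing to `q` make both sides decrease; the finite integral of `u` bounds
the first terms, as decreasing limits under integrals require. -/
lemma IsPoissonPointProcess.lintegral_mecke_of_lintegral_ne_top
    (hX : IsPoissonPointProcess X μ P) {u : E → ℝ≥0∞} (hu : Measurable u)
    (hu_top : ∫⁻ x, u x ∂μ ≠ ∞)
    {f : ℝ≥0∞ → E → ℝ≥0∞} (hf : Measurable fun p : ℝ≥0∞ × E => f p.1 p.2) (hf_top : ∀ s x, f s x ≠ ∞)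
    (hf_mono : ∀ x, Monotone fun s => f s x)
    (hf_sup : ∀ (a : ℕ → ℝ≥0∞) (x : E), Monotone a → f (⨆ n, a n) x = ⨆ n, f (a n) x)
    {q : E → ℝ≥0∞} (hq : Measurable q) :
    ∫⁻ ω, ∑' i, u (X i ω) * expNeg (∑' j, if j = i then 0 else f (q (X i ω)) (X j ω)) ∂P =
      ∫⁻ x, u x * expNeg (∫⁻ y, (1 - expNeg (f (q x) y)) ∂μ) ∂μ := by
  have hqn (x : E) : f (q x) = fun y => ⨆ n, f (SimpleFunc.eapprox q n x) y := by
    ext y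
    rw [← hf_sup _ _ fun m n hmn => SimpleFunc.monotone_eapprox q hmn x,
      SimpleFunc.iSup_eapprox_apply hq]
  have hqn_mono (x y : E) : Monotone fun n => f (SimpleFunc.eapprox q n x) y :=
    fun m n hmn => hf_mono y (SimpleFunc.monotone_eapprox q hmn x)
  have hfs (s : ℝ≥0∞) : Measurable (f s) := hf.comp measurable_prodMk_left
  have hmu {a : ℝ≥0∞} (ha : a ≠ ∞) (g : ℕ → ℝ≥0∞) : a * ⨅ n, g n = ⨅ n, a * g n :=
    ENNReal.mul_iInf fun h => (ha h).elim
  let G : ℕ → Ω → ℕ → ℝ≥0∞ := fun n ω i =>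
    u (X i ω) * expNeg (∑' j, if j = i then 0 else f (SimpleFunc.eapprox q n (X i ω)) (X j ω))
  have hG_anti (ω : Ω) : Antitone fun n => G n ω := fun m n hmn i => by
    refine mul_le_mul_right (expNeg_antitone (ENNReal.tsum_le_tsum fun j => ?_)) _
    split_ifs
    · exact le_rfl
    · exact hqn_mono _ _ hmn
  have hG_meas (n i : ℕ) : Measurable fun ω => G n ω i := by
    refine (hu.comp (hX.measurable i)).mul
      (measurable_expNeg.comp (Measurable.tsum fun j => ?_))
    split_ifs
    · exact measurable_const
    · exact hf.comp
        (((SimpleFunc.eapprox q n).measurable.comp (hX.measurable i)).prodMk (hX.measurable j))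
  have hG_le (n : ℕ) (ω : Ω) : ∑' i, G n ω i ≤ ∑' i, u (X i ω) :=
    ENNReal.tsum_le_tsum fun i => mul_le_of_le_one_right bot_le (expNeg_le_one _)
  have hu_sum := hX.lintegral_tsum hu
  have hfin : ∀ᵐ ω ∂P, ∑' i, u (X i ω) < ∞ :=
    ae_lt_top (Measurable.tsum fun i => hu.comp (hX.measurable i)) (hu_sum ▸ hu_top)
  have hleft : ∀ᵐ ω ∂P,
      ∑' i, u (X i ω) * expNeg (∑' j, if j = i then 0 else f (q (X i ω)) (X j ω)) =
        ⨅ n, ∑' i, G n ω i := by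
    filter_upwards [hfin] with ω hω
    -- As an integral against counting measure, the sum commutes with the decreasing limit, because
    -- its first term is finite for almost every `ω`.
    simp_rw [← lintegral_count (f := G _ ω)]
    rw [← lintegral_iInf (fun n => measurable_from_top) (hG_anti ω), lintegral_count]
    · refine tsum_congr fun i => ?_
      simp only [G]
      rw [← hmu (ne_top_of_le_ne_top hω.ne (ENNReal.le_tsum i)), ← expNeg_iSup,
        ← tsum_iSup_of_monotone]
      · congr 2
        refine tsum_congr fun j => ?_
        split_ifs
        · simp
        · rw [hqn]
      · intro m n hmn j
        dsimp only
        split_ifs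
        · exact le_rfl
        · exact hqn_mono _ _ hmn
    · rw [lintegral_count]
      exact ((hG_le 0 ω).trans_lt hω).ne
  have hI_meas (n : ℕ) : Measurable fun x =>
      ∫⁻ y, (1 - expNeg (f (SimpleFunc.eapprox q n x) y)) ∂μ := by
    refine Measurable.lintegral_prod_right' (f := fun p : E × E =>
      1 - expNeg (f (SimpleFunc.eapprox q n p.1) p.2)) ?_
    exact (measurable_expNeg.comp (hf.comp
      (((SimpleFunc.eapprox q n).measurable.comp measurable_fst).prodMk
        measurable_snd))).const_sub 1
  have hright : ∀ᵐ x ∂μ, u x * expNeg (∫⁻ y, (1 - expNeg (f (q x) y)) ∂μ) =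
      ⨅ n, u x * expNeg (∫⁻ y, (1 - expNeg (f (SimpleFunc.eapprox q n x) y)) ∂μ) := by
    filter_upwards [ae_lt_top hu hu_top] with x hx
    rw [← hmu hx.ne, ← expNeg_iSup, ← lintegral_iSup]
    · simp_rw [← ENNReal.sub_iInf, ← expNeg_iSup, hqn]
    · exact fun n => (measurable_expNeg.comp (hfs _)).const_sub 1
    · exact fun m n hmn y => tsub_le_tsub_left (expNeg_antitone (hqn_mono x y hmn)) 1
  rw [lintegral_congr_ae hleft, lintegral_congr_ae hright, lintegral_iInf, lintegral_iInf]
  · exact iInf_congr fun n => hX.lintegral_mecke_simpleFunc hu hfs hf_top _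
  · exact fun n => hu.mul (measurable_expNeg.comp (hI_meas n))
  · exact fun m n hmn x => mul_le_mul_right (expNeg_antitone (lintegral_mono fun y =>
      tsub_le_tsub_left (expNeg_antitone (hqn_mono x y hmn)) 1)) _
  · exact ne_top_of_le_ne_top hu_top
      (lintegral_mono fun x => mul_le_of_le_one_right bot_le (expNeg_le_one _))
  · exact fun n => Measurable.tsum fun i => hG_meas n i
  · exact fun m n hmn ω => ENNReal.tsum_le_tsum fun i => hG_anti ω hmn i
  · exact ne_top_of_le_ne_top (hu_sum ▸ hu_top) (lintegral_mono fun ω => hG_le 0 ω)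

/-- The Mecke formula for exponentials of linear statistics. -/
theorem IsPoissonPointProcess.lintegral_mecke
    (hX : IsPoissonPointProcess X μ P) {u : E → ℝ≥0∞} (hu : Measurable u)
    (hu_one : ∀ x, u x ≤ 1)
    {f : ℝ≥0∞ → E → ℝ≥0∞} (hf : Measurable fun p : ℝ≥0∞ × E => f p.1 p.2) (hf_top : ∀ s x, f s x ≠ ∞)
    (hf_mono : ∀ x, Monotone fun s => f s x)
    (hf_sup : ∀ (a : ℕ → ℝ≥0∞) (x : E), Monotone a → f (⨆ n, a n) x = ⨆ n, f (a n) x)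
    {q : E → ℝ≥0∞} (hq : Measurable q) :
    ∫⁻ ω, ∑' i, u (X i ω) * expNeg (∑' j, if j = i then 0 else f (q (X i ω)) (X j ω)) ∂P =
      ∫⁻ x, u x * expNeg (∫⁻ y, (1 - expNeg (f (q x) y)) ∂μ) ∂μ := by
  -- Since `u ≤ 1`, truncation to sets of finite intensity yields integrable weights; the truncation
  -- is then lifted by monotone convergence.
  let v : ℕ → E → ℝ≥0∞ := fun n => (spanningSets μ n).indicator u
  have hv (n : ℕ) : Measurable (v n) := hu.indicator (measurableSet_spanningSets μ n)
  have hv_mono (x : E) : Monotone fun n => v n x := fun m n hmn =>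
    Set.indicator_le_indicator_of_subset (monotone_spanningSets μ hmn) (fun _ => bot_le) x
  have hv_sup (x : E) : u x = ⨆ n, v n x := by
    refine le_antisymm ?_ (iSup_le fun n => Set.indicator_le_self _ _ x)
    obtain ⟨m, hm⟩ : ∃ m, x ∈ spanningSets μ m := by
      rw [← Set.mem_iUnion, iUnion_spanningSets]
      exact Set.mem_univ x
    exact le_iSup_of_le m (Set.indicator_of_mem hm u).ge
  have hv_top (n : ℕ) : ∫⁻ x, v n x ∂μ ≠ ∞ := by
    rw [lintegral_indicator (measurableSet_spanningSets μ n)]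
    refine ((setLIntegral_mono measurable_const fun x _ => hu_one x).trans_lt ?_).ne
    simpa using measure_spanningSets_lt_top μ n
  have hS_meas (i : ℕ) : Measurable fun ω =>
      expNeg (∑' j, if j = i then 0 else f (q (X i ω)) (X j ω)) := by
    refine measurable_expNeg.comp (Measurable.tsum fun j => ?_)
    split_ifs
    · exact measurable_const
    · exact hf.comp ((hq.comp (hX.measurable i)).prodMk (hX.measurable j))
  have hI_meas : Measurable fun x => expNeg (∫⁻ y, (1 - expNeg (f (q x) y)) ∂μ) :=
    measurable_expNeg.comp (Measurable.lintegral_prod_right' (f := fun p : E × E =>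
      1 - expNeg (f (q p.1) p.2)) ((measurable_expNeg.comp (hf.comp
        ((hq.comp measurable_fst).prodMk measurable_snd))).const_sub 1))
  simp_rw [hv_sup, ENNReal.iSup_mul]
  rw [lintegral_iSup]
  · have (ω : Ω) := tsum_iSup_of_monotone (f := fun n i => v n (X i ω) *
      expNeg (∑' j, if j = i then 0 else f (q (X i ω)) (X j ω)))
      fun m n hmn i => mul_le_mul_left (hv_mono _ hmn) _
    simp_rw [this]
    rw [lintegral_iSup]
    · exact iSup_congr fun n =>
        hX.lintegral_mecke_of_lintegral_ne_top (hv n) (hv_top n) hf hf_top hf_mono hf_sup hq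
    · exact fun n => Measurable.tsum fun i => ((hv n).comp (hX.measurable i)).mul (hS_meas i)
    · exact fun m n hmn ω => ENNReal.tsum_le_tsum fun i => mul_le_mul_left (hv_mono _ hmn) _
  · exact fun n => (hv n).mul hI_meas
  · exact fun m n hmn x => mul_le_mul_left (hv_mono _ hmn) _

end PointProcess

/-! ### Independent marks -/

section InfiniteProduct

variable {A : Type*} [MeasurableSpace A] (μ : Measure A) [IsProbabilityMeasure μ]

lemma measurable_update_prod (i : ℕ) :
    Measurable fun p : A × (ℕ → A) => Function.update p.2 i p.1 := by
  refine measurable_pi_lambda _ fun j => ?_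
  by_cases h : j = i
  · subst h; simpa using measurable_fst
  · simp only [Function.update_of_ne h]
    exact (measurable_pi_apply j).comp measurable_snd

/-- Resampling one coordinate of an i.i.d. sequence does not change its law. -/
lemma map_update_infinitePi (i : ℕ) :
    (μ.prod (Measure.infinitePi fun _ : ℕ => μ)).map (fun p => Function.update p.2 i p.1) =
      Measure.infinitePi fun _ : ℕ => μ := by
  classical
  refine Measure.eq_infinitePi _ fun s t ht => ?_
  rw [Measure.map_apply (measurable_update_prod i)
    (MeasurableSet.pi s.countable_toSet fun j _ => ht j)]
  by_cases his : i ∈ s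
  · have : (fun p : A × (ℕ → A) => Function.update p.2 i p.1) ⁻¹' (Set.pi s t) =
        t i ×ˢ Set.pi (s.erase i) t := by
      ext p
      simp only [Set.mem_preimage, Set.mem_pi, Set.mem_prod, Finset.mem_coe, Finset.mem_erase]
      constructor
      · refine fun h => ⟨by simpa using h i his, fun j hj => ?_⟩
        simpa [hj.1] using h j hj.2
      · rintro ⟨h1, h2⟩ j hj
        by_cases hji : j = i
        · subst hji; simpa using h1
        · simpa [hji] using h2 j ⟨hji, hj⟩
    rw [this, Measure.prod_prod, Measure.infinitePi_pi _ fun j _ => ht j,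
      Finset.mul_prod_erase s (fun j => μ (t j)) his]
  · have : (fun p : A × (ℕ → A) => Function.update p.2 i p.1) ⁻¹' (Set.pi s t) =
        Set.univ ×ˢ Set.pi s t := by
      ext p
      simp only [Set.mem_preimage, Set.mem_pi, Set.mem_prod, Finset.mem_coe, Set.mem_univ, true_and]
      refine forall₂_congr fun j hj => ?_
      rw [Function.update_of_ne (ne_of_mem_of_not_mem hj his)]
    rw [this, Measure.prod_prod, Measure.infinitePi_pi _ fun j _ => ht j, measure_univ, one_mul]

/-- Isolates the mark of node `i`, so that it can be integrated separately from the interference,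
which ignores coordinate `i`. -/
lemma lintegral_infinitePi_update (i : ℕ) {F : (ℕ → A) → ℝ≥0∞} (hF : Measurable F) :
    ∫⁻ m, F m ∂(Measure.infinitePi fun _ : ℕ => μ) =
      ∫⁻ a, ∫⁻ m, F (Function.update m i a) ∂(Measure.infinitePi fun _ : ℕ => μ) ∂μ := by
  conv_lhs => rw [← map_update_infinitePi μ i]
  rw [lintegral_map hF (measurable_update_prod i)]
  exact lintegral_prod _ (hF.comp (measurable_update_prod i)).aemeasurable

/-- The Laplace transform of a sum over the coordinates of an i.i.d. sequence. -/
lemma lintegral_expNeg_tsum_infinitePi {Y : ℕ → A → ℝ≥0∞} (hY : ∀ j, Measurable (Y j)) :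
    ∫⁻ m, expNeg (∑' j, Y j (m j)) ∂(Measure.infinitePi fun _ : ℕ => μ) =
      expNeg (∑' j, negLog (∫⁻ a, expNeg (Y j a) ∂μ)) := by
  have hle (j : ℕ) : ∫⁻ a, expNeg (Y j a) ∂μ ≤ 1 :=
    (lintegral_mono fun a => expNeg_le_one _).trans (by simp)
  have hm (j : ℕ) : Measurable fun m : ℕ → A => expNeg (Y j (m j)) :=
    measurable_expNeg.comp ((hY j).comp (measurable_pi_apply j))
  -- Both sides become infima of finite products with factors at most one: independence handles each
  -- product, and the decreasing limit is bounded by one.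
  simp_rw [expNeg_tsum, expNeg_negLog (hle _)]
  rw [lintegral_iInf]
  · refine iInf_congr fun n => ?_
    have hi : iIndepFun (fun j (m : ℕ → A) => expNeg (Y j (m j)))
        (Measure.infinitePi fun _ : ℕ => μ) :=
      iIndepFun_infinitePi (P := fun _ : ℕ => μ) (X := fun j a => expNeg (Y j a))
        fun j => measurable_expNeg.comp (hY j)
    rw [lintegral_prod_eq_prod_lintegral_of_indepFun _ _ hi hm]
    refine Finset.prod_congr rfl fun j _ => ?_
    conv_rhs => rw [← Measure.infinitePi_map_eval (fun _ : ℕ => μ) j]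
    exact (lintegral_map (measurable_expNeg.comp (hY j)) (measurable_pi_apply j)).symm
  · exact fun n => Finset.measurable_prod _ fun j _ => hm j
  · refine fun m n hmn ω => ?_
    exact Finset.prod_le_prod_of_subset_of_le_one' (Finset.range_mono hmn)
      fun j _ _ => expNeg_le_one _
  · simp

end InfiniteProduct

/-! ### The law of one mark -/

instance : IsProbabilityMeasure (expMeasure 1) := isProbabilityMeasure_expMeasure one_pos

lemma lintegral_modeLaw (ρ : ℝ) (φ : Bool → ℝ≥0∞) :
    ∫⁻ t, φ t ∂(modeLaw ρ) = ENNReal.ofReal ρ * φ true + ENNReal.ofReal (1 - ρ) * φ false := by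
  simp [modeLaw, lintegral_add_measure, lintegral_smul_measure, lintegral_dirac]

lemma isProbabilityMeasure_modeLaw {ρ : ℝ} (h0 : 0 ≤ ρ) (h1 : ρ ≤ 1) :
    IsProbabilityMeasure (modeLaw ρ) := ⟨by
  rw [← lintegral_one, lintegral_modeLaw, mul_one, mul_one,
    ← ENNReal.ofReal_add h0 (sub_nonneg.2 h1)]
  simp⟩

lemma isProbabilityMeasure_uniformOn_univ {M : ℕ} (hM : 1 ≤ M) :
    IsProbabilityMeasure (uniformOn (Set.univ : Set (Fin M))) :=
  isProbabilityMeasure_uniformOn Set.finite_univ ⟨⟨0, hM⟩, trivial⟩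

lemma isProbabilityMeasure_markLaw {M : ℕ} (hM : 1 ≤ M) {ρ : ℝ} (h0 : 0 ≤ ρ) (h1 : ρ ≤ 1)
    (ν : Measure ℝ) [IsProbabilityMeasure ν] : IsProbabilityMeasure (markLaw M ρ ν) := by
  have := isProbabilityMeasure_modeLaw h0 h1
  have := isProbabilityMeasure_uniformOn_univ hM
  unfold markLaw
  infer_instance

/-- The role of Rayleigh fading: its tail is exactly an exponential, so a success probability
becomes a Laplace transform of the interference. Infinite thresholds are included. -/
lemma expMeasure_lt_ofReal (c : ℝ≥0∞) :
    expMeasure 1 {h | c < ENNReal.ofReal h} = expNeg c := by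
  induction c with
  | top => simp
  | coe c =>
    have : {h : ℝ | (c : ℝ≥0∞) < ENNReal.ofReal h} = (Set.Iic (c : ℝ))ᶜ := by
      ext h
      rw [Set.mem_ofPred_eq, ← ENNReal.ofReal_coe_nnreal,
        ENNReal.ofReal_lt_ofReal_iff_of_nonneg c.coe_nonneg]
      simp
    rw [this, prob_compl_eq_one_sub measurableSet_Iic, ← ofReal_cdf, cdf_expMeasure_eq one_pos,
      if_pos c.coe_nonneg, ← ENNReal.ofReal_coe_nnreal, expNeg_ofReal c.coe_nonneg,
      ← ENNReal.ofReal_one, ← ENNReal.ofReal_sub]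
    · simp
    · simp

lemma lintegral_one_sub_expNeg_expMeasure {c : ℝ} (hc : 0 ≤ c) :
    ∫⁻ h, (1 - expNeg (ENNReal.ofReal h * ENNReal.ofReal c)) ∂(expMeasure 1) =
      ENNReal.ofReal (c / (1 + c)) := by
  have hint : ∫⁻ h, expNeg (ENNReal.ofReal h * ENNReal.ofReal c) ∂(expMeasure 1) =
      ENNReal.ofReal (1 / (1 + c)) := by
    have hm : Measurable fun h : ℝ => expNeg (ENNReal.ofReal h * ENNReal.ofReal c) :=
      measurable_expNeg.comp (ENNReal.measurable_ofReal.mul_const _)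
    have hpdf : Measurable (gammaPDF 1 1) := (measurable_gammaPDFReal 1 1).ennreal_ofReal
    rw [expMeasure, gammaMeasure, lintegral_withDensity_eq_lintegral_mul _ hpdf hm,
      ← setLIntegral_eq_of_support_subset (s := Set.Ici 0),
      setLIntegral_congr Ioi_ae_eq_Ici.symm]
    · have h1 : ∀ h ∈ Set.Ioi (0 : ℝ),
          (gammaPDF 1 1 * fun h => expNeg (ENNReal.ofReal h * ENNReal.ofReal c)) h =
            ENNReal.ofReal (Real.exp (-(1 + c) * h)) := by
        intro h hh
        have hh' : (0 : ℝ) < h := hh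
        rw [Pi.mul_apply, gammaPDF_of_nonneg hh'.le, ← ENNReal.ofReal_mul hh'.le,
          expNeg_ofReal (by positivity), ← ENNReal.ofReal_mul (by simp; positivity)]
        simp [← Real.exp_add]
        ring_nf
      rw [setLIntegral_congr_fun measurableSet_Ioi h1, ← ofReal_integral_eq_lintegral_ofReal,
        integral_exp_mul_Ioi (by linarith)]
      · rw [mul_zero, Real.exp_zero, neg_div_neg_eq]
      · exact integrableOn_exp_mul_Ioi (by linarith) 0
      · exact .of_forall fun _ => (Real.exp_pos _).le
    · intro h hh
      by_contra hn
      refine hh ?_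
      simp [gammaPDF_of_neg (not_le.1 hn)]
  rw [lintegral_sub, hint, lintegral_one, measure_univ, ← ENNReal.ofReal_one,
    ← ENNReal.ofReal_sub _ (by positivity)]
  · congr 1
    field_simp
    ring
  · exact measurable_expNeg.comp (ENNReal.measurable_ofReal.mul_const _)
  · rw [hint]; simp
  · exact .of_forall fun _ => expNeg_le_one _

/-! ### Radial integrals in the plane -/

/-- The disc `‖x‖² < c` has area `πc`, linear in `c`. Using `‖x‖²` as radial variable gives a
constant density and turns `‖x‖⁴` into a square. -/
lemma map_norm_sq_volume :
    (volume : Measure Plane).map (fun x => ‖x‖ ^ 2) =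
      NNReal.pi • (volume : Measure ℝ).restrict (Set.Ioi 0) := by
  symm
  have hm : Measurable fun x : Plane => ‖x‖ ^ 2 := measurable_norm.pow_const 2
  refine Measure.ext_of_Ico _ _ fun a b hab => ?_
  have hball (c : ℝ) : {x : Plane | ‖x‖ ^ 2 < c} = Metric.ball 0 √c := by
    ext x
    rw [mem_ball_zero_iff, Real.lt_sqrt (norm_nonneg x)]
    rfl
  have hvol (c : ℝ) : volume (Metric.ball (0 : Plane) √c) =
      ENNReal.ofReal c * ENNReal.ofReal Real.pi := by
    rw [EuclideanSpace.volume_ball_fin_two, ← ENNReal.ofReal_pow (Real.sqrt_nonneg c)]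
    rcases le_total 0 c with hc | hc
    · rw [Real.sq_sqrt hc]
    · simp [Real.sqrt_eq_zero_of_nonpos hc, ENNReal.ofReal_of_nonpos hc]
  have hpre : (fun x : Plane => ‖x‖ ^ 2) ⁻¹' Set.Ico a b =
      Metric.ball 0 √b \ Metric.ball 0 √a := by
    rw [← hball, ← hball]
    ext x
    simp [and_comm]
  rw [Measure.map_apply hm measurableSet_Ico, hpre,
    measure_sdiff (Metric.ball_subset_ball (Real.sqrt_le_sqrt hab.le))
      measurableSet_ball.nullMeasurableSet measure_ball_lt_top.ne, hvol, hvol,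
    ← ENNReal.sub_mul fun _ _ => ENNReal.ofReal_ne_top, Measure.smul_apply,
    Measure.restrict_apply measurableSet_Ico, mul_comm]
  have hpi : (ENNReal.ofReal Real.pi) = (NNReal.pi : ℝ≥0∞) := by
    rw [← NNReal.coe_real_pi, ENNReal.ofReal_coe_nnreal]
  rw [hpi, ENNReal.smul_def, smul_eq_mul]
  congr 1
  have hco : volume (Set.Ico a b ∩ Set.Ioi 0) = volume (Set.Ioo a b ∩ Set.Ioi 0) :=
    measure_congr (Ioo_ae_eq_Ico.symm.inter (ae_eq_refl _))
  rw [hco, Set.Ioo_inter_Ioi, Real.volume_Ioo]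
  rcases le_total 0 a with ha | ha
  · rw [max_eq_left ha, ENNReal.ofReal_sub _ ha]
  · rw [max_eq_right ha, ENNReal.ofReal_of_nonpos ha]
    simp

lemma lintegral_norm_sq {φ : ℝ → ℝ≥0∞} (hφ : Measurable φ) :
    ∫⁻ x : Plane, φ (‖x‖ ^ 2) = ENNReal.ofReal Real.pi * ∫⁻ u in Set.Ioi 0, φ u := by
  rw [← lintegral_map (f := φ) hφ (measurable_norm.pow_const 2), map_norm_sq_volume,
    lintegral_smul_measure, ENNReal.smul_def, smul_eq_mul, ← NNReal.coe_real_pi,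
    ENNReal.ofReal_coe_nnreal]

lemma lintegral_Ioi_comp_mul_left {k : ℝ} (hk : 0 < k) {φ : ℝ → ℝ≥0∞} (hφ : Measurable φ) :
    ∫⁻ u in Set.Ioi 0, φ u = ENNReal.ofReal k * ∫⁻ v in Set.Ioi 0, φ (k * v) := by
  rw [← lintegral_indicator measurableSet_Ioi, ← lintegral_indicator measurableSet_Ioi]
  conv_lhs => rw [← Real.smul_map_volume_mul_left hk.ne']
  rw [lintegral_smul_measure, lintegral_map (hφ.indicator measurableSet_Ioi)
    (measurable_const_mul k), abs_of_pos hk, smul_eq_mul]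
  congr 1
  refine lintegral_congr fun v => ?_
  simp only [Set.indicator_apply, Set.mem_Ioi, mul_pos_iff_of_pos_left hk]

lemma lintegral_Ioi_inv_one_add_sq :
    ∫⁻ v in Set.Ioi (0 : ℝ), ENNReal.ofReal (1 + v ^ 2)⁻¹ = ENNReal.ofReal (Real.pi / 2) := by
  rw [← ofReal_integral_eq_lintegral_ofReal integrable_inv_one_add_sq.integrableOn
    (.of_forall fun v => by positivity), integral_Ioi_inv_one_add_sq]
  simp

/-- The substitution `u = √a v` turns the integrand into `1/(1 + v²)`. -/
lemma lintegral_Ioi_div_sq_add {a : ℝ} (ha : 0 ≤ a) :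
    ∫⁻ u in Set.Ioi (0 : ℝ), ENNReal.ofReal (a / u ^ 2 / (1 + a / u ^ 2)) =
      ENNReal.ofReal (√a * (Real.pi / 2)) := by
  rcases ha.eq_or_lt with rfl | ha
  · simp
  have hs : 0 < √a := Real.sqrt_pos.2 ha
  have hm : Measurable fun u : ℝ => ENNReal.ofReal (a / u ^ 2 / (1 + a / u ^ 2)) := by fun_prop
  rw [lintegral_Ioi_comp_mul_left hs hm, ENNReal.ofReal_mul hs.le, ← lintegral_Ioi_inv_one_add_sq]
  congr 1
  refine setLIntegral_congr_fun measurableSet_Ioi fun v hv => ?_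
  have hv' : (0 : ℝ) < v := hv
  simp only [mul_pow, Real.sq_sqrt ha.le]
  congr 1
  field_simp
  ring

/-- The mean interference functional of one unit-density Poisson field of Rayleigh-faded
transmitters, for path loss exponent four. -/
lemma lintegral_one_sub_expNeg_pathLoss (ν : Measure ℝ) [IsProbabilityMeasure ν]
    (hν : ∀ᵐ t ∂ν, 0 < t) (hint : Integrable (fun t : ℝ => t ^ ((2 : ℝ) / 4)) ν) {s : ℝ}
    (hs : 0 ≤ s) :
    ∫⁻ y : Plane, ∫⁻ z : ℝ × ℝ, (1 - expNeg (ENNReal.ofReal s *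
        (ENNReal.ofReal (z.1 * z.2) * ENNReal.ofReal ‖y‖ ^ (-4 : ℝ)))) ∂((expMeasure 1).prod ν) =
      ENNReal.ofReal (Real.pi ^ 2 / 2 * √s * ∫ t, t ^ ((2 : ℝ) / 4) ∂ν) := by
  have hm : Measurable fun p : Plane × (ℝ × ℝ) => 1 - expNeg (ENNReal.ofReal s *
      (ENNReal.ofReal (p.2.1 * p.2.2) * ENNReal.ofReal ‖p.1‖ ^ (-4 : ℝ))) := by
    refine (measurable_expNeg.comp ?_).const_sub 1
    fun_prop
  have hm1 (y : Plane) := hm.comp (measurable_prodMk_left (x := y))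
  have hmu : Measurable fun p : Plane × ℝ => ∫⁻ h, (1 - expNeg (ENNReal.ofReal s *
      (ENNReal.ofReal (h * p.2) * ENNReal.ofReal ‖p.1‖ ^ (-4 : ℝ)))) ∂(expMeasure 1) := by
    refine Measurable.lintegral_prod_right' (f := fun q : (Plane × ℝ) × ℝ =>
      1 - expNeg (ENNReal.ofReal s *
      (ENNReal.ofReal (q.2 * q.1.2) * ENNReal.ofReal ‖q.1.1‖ ^ (-4 : ℝ)))) ?_
    exact hm.comp (f := fun q : (Plane × ℝ) × ℝ => (q.1.1, (q.2, q.1.2))) (by fun_prop)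
  have hstep (t : ℝ) (ht : 0 < t) : ∫⁻ y : Plane, ∫⁻ h, (1 - expNeg (ENNReal.ofReal s *
      (ENNReal.ofReal (h * t) * ENNReal.ofReal ‖y‖ ^ (-4 : ℝ)))) ∂(expMeasure 1) =
        ENNReal.ofReal (Real.pi ^ 2 / 2 * √s) * ENNReal.ofReal (t ^ ((2 : ℝ) / 4)) := by
    have h1 : ∀ᵐ y : Plane, ∫⁻ h, (1 - expNeg (ENNReal.ofReal s *
        (ENNReal.ofReal (h * t) * ENNReal.ofReal ‖y‖ ^ (-4 : ℝ)))) ∂(expMeasure 1) =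
          ENNReal.ofReal (s * t / (‖y‖ ^ 2) ^ 2 / (1 + s * t / (‖y‖ ^ 2) ^ 2)) := by
      -- The origin must be excluded: there the extended path loss is `∞`, whereas real division by
      -- zero gives `0`.
      filter_upwards [Measure.ae_ne volume (0 : Plane)] with y hy
      have hy' : 0 < ‖y‖ := norm_pos_iff.2 hy
      rw [← lintegral_one_sub_expNeg_expMeasure (by positivity)]
      refine lintegral_congr fun h => ?_
      congr 2
      rw [ENNReal.ofReal_mul' ht.le, ENNReal.ofReal_rpow_of_pos hy', mul_div_assoc,
        ENNReal.ofReal_mul hs, mul_assoc, mul_left_comm, ← ENNReal.ofReal_mul ht.le]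
      congr 4
      rw [Real.rpow_neg hy'.le, ← pow_mul]
      norm_cast
    have hm2 : Measurable fun u : ℝ => ENNReal.ofReal (s * t / u ^ 2 / (1 + s * t / u ^ 2)) := by
      fun_prop
    rw [lintegral_congr_ae h1, lintegral_norm_sq hm2, lintegral_Ioi_div_sq_add (by positivity),
      ← ENNReal.ofReal_mul Real.pi_pos.le, ← ENNReal.ofReal_mul (by positivity),
      Real.sqrt_mul hs, Real.sqrt_eq_rpow t]
    congr 1
    norm_num
    ring
  calc _ = ∫⁻ y : Plane, ∫⁻ t, ∫⁻ h, (1 - expNeg (ENNReal.ofReal s *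
      (ENNReal.ofReal (h * t) * ENNReal.ofReal ‖y‖ ^ (-4 : ℝ)))) ∂(expMeasure 1) ∂ν :=
        lintegral_congr fun y => lintegral_prod_symm' _ (hm1 y)
    _ = ∫⁻ t, (∫⁻ y : Plane, ∫⁻ h, (1 - expNeg (ENNReal.ofReal s *
      (ENNReal.ofReal (h * t) * ENNReal.ofReal ‖y‖ ^ (-4 : ℝ)))) ∂(expMeasure 1)) ∂ν :=
        lintegral_lintegral_swap hmu.aemeasurable
    _ = ∫⁻ t, ENNReal.ofReal (Real.pi ^ 2 / 2 * √s) * ENNReal.ofReal (t ^ ((2 : ℝ) / 4)) ∂ν :=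
        lintegral_congr_ae (hν.mono hstep)
    _ = _ := by
        rw [lintegral_const_mul' _ _ ENNReal.ofReal_ne_top, ← ofReal_integral_eq_lintegral_ofReal
          hint (hν.mono fun t ht => Real.rpow_nonneg ht.le _), ← ENNReal.ofReal_mul (by positivity)]

/-! ### The interference of one node -/

/-- The power received over the block `b` from a node with mark `a` located at `y`. -/
noncomputable def markPower {M : ℕ} (b : Fin M) (y : Plane) (a : Bool × Fin M × ℝ × ℝ) : ℝ≥0∞ :=
  if a.1 = true ∧ a.2.1 = b then
    ENNReal.ofReal (a.2.2.1 * a.2.2.2) * ENNReal.ofReal ‖y‖ ^ (-4 : ℝ) else 0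

/-- One minus the Laplace transform at `s` of the power received over a given block from a node
located at `y`. -/
noncomputable def disturbance (M : ℕ) (ρ : ℝ) (ν : Measure ℝ) (s : ℝ≥0∞) (y : Plane) : ℝ≥0∞ :=
  ENNReal.ofReal ρ * (M : ℝ≥0∞)⁻¹ * ∫⁻ z : ℝ × ℝ, (1 - expNeg (s *
    (ENNReal.ofReal (z.1 * z.2) * ENNReal.ofReal ‖y‖ ^ (-4 : ℝ)))) ∂((expMeasure 1).prod ν)

lemma lintegral_uniformOn_univ {M : ℕ} (φ : Fin M → ℝ≥0∞) :
    ∫⁻ b, φ b ∂(uniformOn (Set.univ : Set (Fin M))) = (M : ℝ≥0∞)⁻¹ * ∑ b, φ b := by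
  rw [uniformOn, ProbabilityTheory.cond, lintegral_smul_measure, Measure.restrict_univ, lintegral_count,
    tsum_fintype, smul_eq_mul]
  simp [Measure.count_univ]

lemma lintegral_markLaw {M : ℕ} (hM : 1 ≤ M) {ρ : ℝ} {ν : Measure ℝ} [IsProbabilityMeasure ν]
    {φ : Bool × Fin M × ℝ × ℝ → ℝ≥0∞} (hφ : Measurable φ) :
    ∫⁻ a, φ a ∂(markLaw M ρ ν) =
      ENNReal.ofReal ρ * ∫⁻ b, ∫⁻ z, φ (true, b, z) ∂((expMeasure 1).prod ν) ∂(uniformOn Set.univ)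
      + ENNReal.ofReal (1 - ρ) *
        ∫⁻ b, ∫⁻ z, φ (false, b, z) ∂((expMeasure 1).prod ν) ∂(uniformOn Set.univ) := by
  have := isProbabilityMeasure_uniformOn_univ hM
  have h (t : Bool) : Measurable fun p : Fin M × ℝ × ℝ => φ (t, p) := hφ.comp measurable_prodMk_left
  rw [markLaw, lintegral_prod _ hφ.aemeasurable, lintegral_modeLaw,
    lintegral_prod _ (h true).aemeasurable, lintegral_prod _ (h false).aemeasurable]

section Disturbance

variable {M : ℕ} {ρ : ℝ} {ν : Measure ℝ}

/-- The logarithmic Laplace transform at `s` of the power received over a given block from a node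
located at `y`. -/
noncomputable def logDisturbance (M : ℕ) (ρ : ℝ) (ν : Measure ℝ) (s : ℝ≥0∞) (y : Plane) : ℝ≥0∞ :=
  negLog (1 - disturbance M ρ ν s y)

lemma expNeg_logDisturbance (s : ℝ≥0∞) (y : Plane) :
    expNeg (logDisturbance M ρ ν s y) = 1 - disturbance M ρ ν s y :=
  expNeg_negLog tsub_le_self

lemma disturbance_mono (y : Plane) : Monotone fun s => disturbance M ρ ν s y :=
  fun _ _ h => mul_le_mul_right (lintegral_mono fun _ =>
    tsub_le_tsub_left (expNeg_antitone (mul_le_mul_left h _)) 1) _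

lemma disturbance_iSup {a : ℕ → ℝ≥0∞} (ha : Monotone a) (y : Plane) :
    disturbance M ρ ν (⨆ n, a n) y = ⨆ n, disturbance M ρ ν (a n) y := by
  simp_rw [disturbance]
  rw [← ENNReal.mul_iSup, ← lintegral_iSup]
  · simp_rw [ENNReal.iSup_mul, expNeg_iSup, ENNReal.sub_iInf]
  · exact fun n => (measurable_expNeg.comp (by fun_prop)).const_sub 1
  · exact fun m n hmn z => tsub_le_tsub_left (expNeg_antitone (mul_le_mul_left (ha hmn) _)) 1

lemma logDisturbance_mono (y : Plane) : Monotone fun s => logDisturbance M ρ ν s y :=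
  fun _ _ h => negLog_antitone (tsub_le_tsub_left (disturbance_mono y h) 1)

/-- Continuity from below in `s`, as the Mecke formula demands; passing through the injective
`expNeg` reduces it to the disturbance. -/
lemma logDisturbance_iSup {a : ℕ → ℝ≥0∞} (ha : Monotone a) (y : Plane) :
    logDisturbance M ρ ν (⨆ n, a n) y = ⨆ n, logDisturbance M ρ ν (a n) y := by
  apply expNeg_injective
  rw [expNeg_iSup]
  simp_rw [expNeg_logDisturbance]
  rw [disturbance_iSup ha, ENNReal.sub_iSup ENNReal.one_ne_top]

variable [IsProbabilityMeasure ν]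

lemma measurable_markPower (b : Fin M) :
    Measurable fun p : Plane × (Bool × Fin M × ℝ × ℝ) => markPower b p.1 p.2 := by
  unfold markPower
  refine Measurable.ite ?_ (by fun_prop) measurable_const
  exact (measurableSet_eq_fun (by fun_prop) measurable_const).inter
    (measurableSet_eq_fun (by fun_prop) measurable_const)

/-- A node disturbs only if it transmits. For `ρ < 1` this bounds the Laplace transform away from
zero, so that its logarithm is finite and a single point can be divided out. -/
lemma disturbance_le (hM : 1 ≤ M) (s : ℝ≥0∞) (y : Plane) :
    disturbance M ρ ν s y ≤ ENNReal.ofReal ρ := by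
  have h1 : ∫⁻ z : ℝ × ℝ, (1 - expNeg (s * (ENNReal.ofReal (z.1 * z.2) *
      ENNReal.ofReal ‖y‖ ^ (-4 : ℝ)))) ∂((expMeasure 1).prod ν) ≤ 1 :=
    (lintegral_mono fun z => tsub_le_self).trans (by simp)
  have h2 : (M : ℝ≥0∞)⁻¹ ≤ 1 := ENNReal.inv_le_one.2 (by exact_mod_cast hM)
  unfold disturbance
  exact (mul_le_of_le_one_right bot_le h1).trans (mul_le_of_le_one_right bot_le h2)

lemma measurable_disturbance :
    Measurable fun p : ℝ≥0∞ × Plane => disturbance M ρ ν p.1 p.2 := by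
  refine Measurable.const_mul (Measurable.lintegral_prod_right'
    (f := fun q : (ℝ≥0∞ × Plane) × (ℝ × ℝ) => 1 - expNeg (q.1.1 *
      (ENNReal.ofReal (q.2.1 * q.2.2) * ENNReal.ofReal ‖q.1.2‖ ^ (-4 : ℝ)))) ?_) _
  exact (measurable_expNeg.comp (by fun_prop)).const_sub 1

/-- For `1 - expNeg` instead of `expNeg`, silent nodes and nodes on other blocks contribute zero;
the one remaining mode and block carry the weight `ρ/M`. -/
lemma lintegral_expNeg_markPower (hM : 1 ≤ M) (hρ₀ : 0 ≤ ρ) (hρ₁ : ρ ≤ 1) (s : ℝ≥0∞) (b : Fin M)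
    (y : Plane) :
    ∫⁻ a, expNeg (s * markPower b y a) ∂(markLaw M ρ ν) = 1 - disturbance M ρ ν s y := by
  have := isProbabilityMeasure_markLaw hM hρ₀ hρ₁ ν
  have hm : Measurable fun a => expNeg (s * markPower b y a) :=
    measurable_expNeg.comp (((measurable_markPower b).comp measurable_prodMk_left).const_mul s)
  have hle : ∫⁻ a, expNeg (s * markPower b y a) ∂(markLaw M ρ ν) ≤ 1 :=
    (lintegral_mono fun a => expNeg_le_one _).trans (by simp)
  have hsub : 1 - ∫⁻ a, expNeg (s * markPower b y a) ∂(markLaw M ρ ν) =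
      disturbance M ρ ν s y := by
    have h := lintegral_sub (μ := markLaw M ρ ν) (f := fun _ => 1) hm
      (ne_top_of_le_ne_top ENNReal.one_ne_top hle) (.of_forall fun a => expNeg_le_one _)
    rw [lintegral_one, measure_univ] at h
    rw [← h, lintegral_markLaw hM (hm.const_sub 1)]
    simp only [markPower, lintegral_uniformOn_univ]
    rw [Finset.sum_eq_single b (fun b' _ hb' => by simp [hb']) (by simp)]
    simp [disturbance, mul_assoc]
  rw [← hsub, ENNReal.sub_sub_cancel ENNReal.one_ne_top hle]

lemma one_sub_expNeg_logDisturbance (hM : 1 ≤ M) (hρ₁ : ρ ≤ 1) (s : ℝ≥0∞) (y : Plane) :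
    1 - expNeg (logDisturbance M ρ ν s y) = disturbance M ρ ν s y := by
  rw [expNeg_logDisturbance, ENNReal.sub_sub_cancel ENNReal.one_ne_top]
  exact (disturbance_le hM s y).trans (ENNReal.ofReal_le_one.2 hρ₁)

lemma logDisturbance_ne_top (hM : 1 ≤ M) (hρ₁ : ρ < 1) (s : ℝ≥0∞) (y : Plane) :
    logDisturbance M ρ ν s y ≠ ∞ :=
  negLog_ne_top (tsub_pos_of_lt
    ((disturbance_le hM s y).trans_lt (ENNReal.ofReal_lt_one.2 hρ₁))).ne'

lemma measurable_logDisturbance :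
    Measurable fun p : ℝ≥0∞ × Plane => logDisturbance M ρ ν p.1 p.2 :=
  measurable_negLog.comp (measurable_disturbance.const_sub 1)

lemma lintegral_disturbance (hν : ∀ᵐ t ∂ν, 0 < t)
    (hint : Integrable (fun t : ℝ => t ^ ((2 : ℝ) / 4)) ν) (hM : 1 ≤ M) (hρ₀ : 0 ≤ ρ)
    {lam : ℝ} (hlam : 0 ≤ lam) {s : ℝ} (hs : 0 ≤ s) :
    ∫⁻ y, disturbance M ρ ν (ENNReal.ofReal s) y ∂(ENNReal.ofReal lam • (volume : Measure Plane)) =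
      ENNReal.ofReal (effectiveDensity 4 lam ν * (ρ / M * (Real.pi ^ 2 / 2)) * √s) := by
  have hc : ENNReal.ofReal ρ * (M : ℝ≥0∞)⁻¹ ≠ ∞ :=
    ENNReal.mul_ne_top ENNReal.ofReal_ne_top (ENNReal.inv_ne_top.2 (by positivity))
  have hMpos : (0 : ℝ) < M := by exact_mod_cast hM
  have hc' : ENNReal.ofReal ρ * (M : ℝ≥0∞)⁻¹ = ENNReal.ofReal (ρ / M) := by
    rw [ENNReal.ofReal_div_of_pos hMpos, ENNReal.ofReal_natCast, div_eq_mul_inv]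
  rw [lintegral_smul_measure]
  simp_rw [disturbance]
  rw [lintegral_const_mul' _ _ hc, lintegral_one_sub_expNeg_pathLoss ν hν hint hs, hc',
    ← ENNReal.ofReal_mul (by positivity), smul_eq_mul, ← ENNReal.ofReal_mul hlam, effectiveDensity]
  congr 1
  ring

end Disturbance

/-! ### The discovery of one node, given the locations -/

/-- The power that interferes with the packet of node `i`, as a function of the locations and the
marks of the nodes. -/
noncomputable def configInterference {M : ℕ} (b : Fin M) (i : ℕ) (x : ℕ → Plane)
    (m : ℕ → Bool × Fin M × ℝ × ℝ) : ℝ≥0∞ :=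
  ∑' j, if j = i then 0 else markPower b (x j) (m j)

/-- The indicator of the event that the packet of node `i`, with mark `a`, can be decoded at the
origin. -/
noncomputable def decodable {M : ℕ} (noise ξ : ℝ) (i : ℕ) (x : ℕ → Plane)
    (a : Bool × Fin M × ℝ × ℝ) (m : ℕ → Bool × Fin M × ℝ × ℝ) : ℝ≥0∞ :=
  if a.1 = true ∧ ENNReal.ofReal ξ * (configInterference a.2.1 i x m + ENNReal.ofReal noise) <
    ENNReal.ofReal (a.2.2.1 * a.2.2.2) * ENNReal.ofReal ‖x i‖ ^ (-4 : ℝ) then 1 else 0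

section

variable {M : ℕ} {noise ξ : ℝ}

lemma measurable_configInterference (i : ℕ) :
    Measurable fun p : Fin M × (ℕ → Plane) × (ℕ → Bool × Fin M × ℝ × ℝ) =>
      configInterference p.1 i p.2.1 p.2.2 := by
  refine measurable_from_prod_countable_right fun b => ?_
  unfold configInterference
  refine Measurable.tsum fun j => ?_
  split_ifs
  · exact measurable_const
  · exact (measurable_markPower b).comp
      (f := fun p : (ℕ → Plane) × (ℕ → Bool × Fin M × ℝ × ℝ) => (p.1 j, p.2 j)) (by fun_prop)

lemma measurable_decodable (i : ℕ) :
    Measurable fun p : (ℕ → Plane) × (Bool × Fin M × ℝ × ℝ) × (ℕ → Bool × Fin M × ℝ × ℝ) =>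
      decodable noise ξ i p.1 p.2.1 p.2.2 := by
  unfold decodable
  have h := (measurable_configInterference (M := M) i).comp
    (f := fun p : (ℕ → Plane) × (Bool × Fin M × ℝ × ℝ) × (ℕ → Bool × Fin M × ℝ × ℝ) =>
      (p.2.1.2.1, p.1, p.2.2)) (by fun_prop)
  refine Measurable.ite ?_ measurable_const measurable_const
  exact (measurableSet_eq_fun (by fun_prop) measurable_const).inter
    (measurableSet_lt ((h.add_const _).const_mul _) (by fun_prop))

lemma configInterference_update (b : Fin M) (i : ℕ) (x : ℕ → Plane)
    (m : ℕ → Bool × Fin M × ℝ × ℝ) (a : Bool × Fin M × ℝ × ℝ) :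
    configInterference b i x (Function.update m i a) = configInterference b i x m := by
  refine tsum_congr fun j => ?_
  split_ifs with h
  · rfl
  · rw [Function.update_of_ne h]

lemma lintegral_expNeg_configInterference (hM : 1 ≤ M) {ρ : ℝ} (hρ₀ : 0 ≤ ρ) (hρ₁ : ρ ≤ 1)
    {ν : Measure ℝ} [IsProbabilityMeasure ν] (s : ℝ≥0∞) (b : Fin M) (i : ℕ) (x : ℕ → Plane) :
    ∫⁻ m, expNeg (s * configInterference b i x m)
        ∂(Measure.infinitePi fun _ : ℕ => markLaw M ρ ν) =
      expNeg (∑' j, if j = i then 0 else logDisturbance M ρ ν s (x j)) := by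
  have := isProbabilityMeasure_markLaw hM hρ₀ hρ₁ ν
  simp_rw [configInterference, ← ENNReal.tsum_mul_left]
  rw [lintegral_expNeg_tsum_infinitePi (markLaw M ρ ν)
    (Y := fun j a => s * if j = i then 0 else markPower b (x j) a)]
  · congr 1
    refine tsum_congr fun j => ?_
    split_ifs
    · rw [mul_zero, expNeg_zero, lintegral_one, measure_univ]
      simp [negLog]
    · rw [lintegral_expNeg_markPower hM hρ₀ hρ₁, logDisturbance]
  · intro j
    split_ifs
    · exact measurable_const
    · exact ((measurable_markPower b).comp measurable_prodMk_left).const_mul s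

/-- The probability of the Rayleigh fading to overcome a given interference. -/
lemma expMeasure_decodable {t r : ℝ} (ht : 0 < t) (hr : 0 < r) (I : ℝ≥0∞) :
    expMeasure 1 {h | ENNReal.ofReal ξ * I < ENNReal.ofReal (h * t) *
      ENNReal.ofReal r ^ (-4 : ℝ)} = expNeg (ENNReal.ofReal (ξ * r ^ 4 / t) * I) := by
  rw [← expMeasure_lt_ofReal]
  congr 1
  ext h
  simp only [Set.mem_ofPred_eq]
  have hk : 0 < t * r ^ (-4 : ℝ) := by positivity
  have h1 : ENNReal.ofReal (h * t) * ENNReal.ofReal r ^ (-4 : ℝ) =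
      ENNReal.ofReal (t * r ^ (-4 : ℝ)) * ENNReal.ofReal h := by
    rw [ENNReal.ofReal_mul' ht.le, ENNReal.ofReal_rpow_of_pos hr, ENNReal.ofReal_mul ht.le]
    ring
  have h2 : ENNReal.ofReal ξ = ENNReal.ofReal (t * r ^ (-4 : ℝ)) *
      ENNReal.ofReal (ξ * r ^ 4 / t) := by
    rw [← ENNReal.ofReal_mul hk.le, Real.rpow_neg hr.le]
    congr 1
    norm_cast
    field_simp
  rw [h1, h2, mul_assoc]
  exact ENNReal.mul_lt_mul_iff_right (ENNReal.ofReal_pos.2 hk).ne' ENNReal.ofReal_ne_top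

/-- Resample mark `i` independently of the rest. Its mode gives `ρ`, every block gives the same
value, and its fading is integrated before the other marks, leaving their Laplace transform. -/
lemma lintegral_decodable (hM : 1 ≤ M) {ρ : ℝ} (hρ₀ : 0 ≤ ρ) (hρ₁ : ρ ≤ 1)
    {ν : Measure ℝ} [IsProbabilityMeasure ν] (hν : ∀ᵐ t ∂ν, 0 < t) (i : ℕ) {x : ℕ → Plane}
    (hx : x i ≠ 0) :
    ∫⁻ m, decodable noise ξ i x (m i) m ∂(Measure.infinitePi fun _ : ℕ => markLaw M ρ ν) =
      ENNReal.ofReal ρ * ∫⁻ t, expNeg (ENNReal.ofReal (ξ * ‖x i‖ ^ 4 / t) * ENNReal.ofReal noise) *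
        expNeg (∑' j, if j = i then 0 else
          logDisturbance M ρ ν (ENNReal.ofReal (ξ * ‖x i‖ ^ 4 / t)) (x j)) ∂ν := by
  have := isProbabilityMeasure_markLaw hM hρ₀ hρ₁ ν
  have := isProbabilityMeasure_uniformOn_univ hM
  set Q := Measure.infinitePi fun _ : ℕ => markLaw M ρ ν
  have hD : Measurable fun p : (Bool × Fin M × ℝ × ℝ) × (ℕ → Bool × Fin M × ℝ × ℝ) =>
      decodable noise ξ i x p.1 p.2 :=
    (measurable_decodable i).comp measurable_prodMk_left
  have hF : Measurable fun m : ℕ → Bool × Fin M × ℝ × ℝ => decodable noise ξ i x (m i) m :=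
    hD.comp (f := fun m : ℕ → Bool × Fin M × ℝ × ℝ => (m i, m)) (by fun_prop)
  rw [lintegral_infinitePi_update _ i hF]
  have hup (a : Bool × Fin M × ℝ × ℝ) (m : ℕ → Bool × Fin M × ℝ × ℝ) :
      decodable noise ξ i x (Function.update m i a i) (Function.update m i a) =
        decodable noise ξ i x a m := by
    simp only [decodable, Function.update_self, configInterference_update]
  simp_rw [hup]
  rw [lintegral_markLaw hM hD.lintegral_prod_right']
  have hfalse (p : Fin M × ℝ × ℝ) (m : ℕ → Bool × Fin M × ℝ × ℝ) :
      decodable noise ξ i x (false, p) m = 0 := by simp [decodable]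
  have hb (b : Fin M) : ∫⁻ z, ∫⁻ m, decodable noise ξ i x (true, b, z) m ∂Q
      ∂((expMeasure 1).prod ν) = ∫⁻ t, expNeg (ENNReal.ofReal (ξ * ‖x i‖ ^ 4 / t) *
        ENNReal.ofReal noise) * expNeg (∑' j, if j = i then 0 else
          logDisturbance M ρ ν (ENNReal.ofReal (ξ * ‖x i‖ ^ 4 / t)) (x j)) ∂ν := by
    have hz : Measurable fun z : ℝ × ℝ => ∫⁻ m, decodable noise ξ i x (true, b, z) m ∂Q :=
      hD.lintegral_prod_right'.comp
        (f := fun z : ℝ × ℝ => ((true, b, z) : Bool × Fin M × ℝ × ℝ)) (by fun_prop)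
    rw [lintegral_prod_symm' _ hz]
    refine lintegral_congr_ae (hν.mono fun t ht => ?_)
    have hhm : Measurable fun p : ℝ × (ℕ → Bool × Fin M × ℝ × ℝ) =>
        decodable noise ξ i x (true, b, p.1, t) p.2 :=
      hD.comp (f := fun p : ℝ × (ℕ → Bool × Fin M × ℝ × ℝ) =>
        (((true, b, p.1, t), p.2) : (Bool × Fin M × ℝ × ℝ) × (ℕ → Bool × Fin M × ℝ × ℝ)))
        (by fun_prop)
    have hfade (m : ℕ → Bool × Fin M × ℝ × ℝ) :
        ∫⁻ h, decodable noise ξ i x (true, b, h, t) m ∂(expMeasure 1) =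
          expNeg (ENNReal.ofReal (ξ * ‖x i‖ ^ 4 / t) * ENNReal.ofReal noise) *
            expNeg (ENNReal.ofReal (ξ * ‖x i‖ ^ 4 / t) * configInterference b i x m) := by
      rw [mul_comm, ← expNeg_add, ← mul_add,
        ← expMeasure_decodable ht (norm_pos_iff.2 hx), ← lintegral_indicator_one]
      · refine lintegral_congr fun h => ?_
        simp [decodable, Set.indicator_apply]
      · exact measurableSet_lt measurable_const (by fun_prop)
    dsimp only
    rw [lintegral_lintegral_swap hhm.aemeasurable]
    simp_rw [hfade]
    rw [lintegral_const_mul' _ _ (expNeg_ne_top _),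
      lintegral_expNeg_configInterference hM hρ₀ hρ₁]
  simp only [Q] at hb
  simp_rw [hfalse, hb]
  simp

end

/-! ### The mean number of discovered nodes -/

instance (c : ℝ) : SigmaFinite (ENNReal.ofReal c • (volume : Measure Plane)) :=
  SMul.sigmaFinite c.toNNReal

instance (c : ℝ) : NullSingletonClass (ENNReal.ofReal c • (volume : Measure Plane)) :=
  ⟨fun x => by simp⟩

lemma encard_eq_tsum (S : Set ℕ) : (S.encard : ℝ≥0∞) = ∑' i, S.indicator 1 i := by
  rw [← lintegral_count, lintegral_indicator_one (MeasurableSet.of_discrete),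
    Measure.count_apply .of_discrete]

namespace HelloSlot

variable {Ω : Type*} [MeasurableSpace Ω] {P : Measure Ω} {M : ℕ} {lam ρ : ℝ} {ν : Measure ℝ}

/-- The mark of node `j`. -/
def mark (s : HelloSlot P M lam ρ ν) (j : ℕ) (ω : Ω) : Bool × Fin M × ℝ × ℝ :=
  (s.transmits j ω, s.block j ω, s.fading j ω, s.shadowing j ω)

lemma indicator_discovered (s : HelloSlot P M lam ρ ν) {noise ξ : ℝ} (hξ : 0 < ξ) (i : ℕ) (ω : Ω) :
    (s.discovered 4 noise ξ ω).indicator (1 : ℕ → ℝ≥0∞) i =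
      (if s.transmits₀ ω = false then 1 else 0) *
        decodable noise ξ i (fun j => s.pos j ω) (s.mark i ω) (fun j => s.mark j ω) := by
  classical
  have hI : s.interference 4 i ω =
      configInterference (s.block i ω) i (fun j => s.pos j ω) (fun j => s.mark j ω) := by
    refine tsum_congr fun j => ?_
    simp only [markPower, mark, receivedPower]
    by_cases hj : j = i <;> simp [hj]
  -- Because `0 < ξ < ∞`, clearing the denominator is valid even when the interference plus noise is
  -- `0` or `∞`.
  have hlt : ENNReal.ofReal ξ < s.sinr 4 noise i ω ↔
      ENNReal.ofReal ξ * (s.interference 4 i ω + ENNReal.ofReal noise) <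
        s.receivedPower 4 i ω :=
    ENNReal.lt_div_iff_mul_lt (.inr ENNReal.ofReal_ne_top) (.inr (ENNReal.ofReal_pos.2 hξ).ne')
  rw [Set.indicator_apply, discovered, Set.mem_ofPred_eq, hlt, hI, decodable]
  simp only [mark, receivedPower, Pi.one_apply]
  by_cases h : s.transmits₀ ω = false <;> simp [h]

variable [IsProbabilityMeasure P] [IsProbabilityMeasure ν]

lemma meanDiscovered_eq_lintegral (s : HelloSlot P M lam ρ ν) (hM : 1 ≤ M) (hρ₀ : 0 ≤ ρ)
    (hρ₁ : ρ ≤ 1) (hν : ∀ᵐ t ∂ν, 0 < t) {noise ξ : ℝ} (hξ : 0 < ξ) :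
    s.meanDiscovered 4 noise ξ = ENNReal.ofReal (1 - ρ) * (ENNReal.ofReal ρ *
      ∫⁻ ω, ∑' i, ∫⁻ t, expNeg (ENNReal.ofReal (ξ * ‖s.pos i ω‖ ^ 4 / t) * ENNReal.ofReal noise) *
        expNeg (∑' j, if j = i then 0 else logDisturbance M ρ ν
          (ENNReal.ofReal (ξ * ‖s.pos i ω‖ ^ 4 / t)) (s.pos j ω)) ∂ν ∂P) := by
  have := isProbabilityMeasure_markLaw hM hρ₀ hρ₁ ν
  have := isProbabilityMeasure_modeLaw hρ₀ hρ₁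
  have hpos : Measurable fun ω j => s.pos j ω := measurable_pi_lambda _ s.isPoisson.measurable
  have : IsProbabilityMeasure (P.map fun ω j => s.pos j ω) :=
    Measure.isProbabilityMeasure_map hpos.aemeasurable
  have hmark (j : ℕ) : Measurable (s.mark j) :=
    (s.measurable_transmits j).prodMk ((s.measurable_block j).prodMk
      ((s.measurable_fading j).prodMk (s.measurable_shadowing j)))
  have hT : Measurable fun ω => ((fun j => s.pos j ω), s.transmits₀ ω, fun j => s.mark j ω) :=
    hpos.prodMk (s.measurable_transmits₀.prodMk (measurable_pi_lambda _ hmark))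
  have hD (i : ℕ) : Measurable fun p : (ℕ → Plane) × (ℕ → Bool × Fin M × ℝ × ℝ) =>
      decodable noise ξ i p.1 (p.2 i) p.2 :=
    (measurable_decodable i).comp (f := fun p : (ℕ → Plane) × (ℕ → Bool × Fin M × ℝ × ℝ) =>
      (p.1, p.2 i, p.2)) (by fun_prop)
  let Φ : (ℕ → Plane) × Bool × (ℕ → Bool × Fin M × ℝ × ℝ) → ℝ≥0∞ := fun p =>
    (if p.2.1 = false then 1 else 0) * ∑' i, decodable noise ξ i p.1 (p.2.2 i) p.2.2
  have hΦ : Measurable Φ := by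
    refine (Measurable.ite (measurableSet_eq_fun (by fun_prop) measurable_const)
      measurable_const measurable_const).mul (Measurable.tsum fun i => ?_)
    exact (hD i).comp (f := fun p : (ℕ → Plane) × Bool × (ℕ → Bool × Fin M × ℝ × ℝ) =>
      (p.1, p.2.2)) (by fun_prop)
  calc s.meanDiscovered 4 noise ξ
      = ∫⁻ ω, Φ ((fun j => s.pos j ω), s.transmits₀ ω, fun j => s.mark j ω) ∂P := by
        refine lintegral_congr fun ω => ?_
        rw [encard_eq_tsum]
        simp_rw [s.indicator_discovered hξ, ENNReal.tsum_mul_left]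
        rfl
    _ = ∫⁻ x, ∫⁻ p, Φ (x, p) ∂((modeLaw ρ).prod (Measure.infinitePi fun _ => markLaw M ρ ν))
          ∂(P.map fun ω j => s.pos j ω) := by
        rw [← lintegral_map hΦ hT, ← lintegral_prod _ hΦ.aemeasurable, ← s.map_eq]
        rfl
    _ = ∫⁻ ω, ∫⁻ p, Φ (fun j => s.pos j ω, p)
          ∂((modeLaw ρ).prod (Measure.infinitePi fun _ => markLaw M ρ ν)) ∂P :=
        lintegral_map hΦ.lintegral_prod_right' hpos
    _ = ∫⁻ ω, ENNReal.ofReal (1 - ρ) * (ENNReal.ofReal ρ * ∑' i, ∫⁻ t,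
          expNeg (ENNReal.ofReal (ξ * ‖s.pos i ω‖ ^ 4 / t) * ENNReal.ofReal noise) *
          expNeg (∑' j, if j = i then 0 else logDisturbance M ρ ν
          (ENNReal.ofReal (ξ * ‖s.pos i ω‖ ^ 4 / t)) (s.pos j ω)) ∂ν) ∂P := by
        have hne : ∀ᵐ ω ∂P, ∀ i, s.pos i ω ≠ 0 := by
          exact s.isPoisson.ae_ne 0
        refine lintegral_congr_ae (hne.mono fun ω hω => ?_)
        have hx : Measurable fun p => Φ (fun j => s.pos j ω, p) := hΦ.comp measurable_prodMk_left
        dsimp only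
        rw [lintegral_prod _ hx.aemeasurable, lintegral_modeLaw]
        simp only [Φ, Bool.true_eq_false, if_false, if_true, zero_mul, one_mul, lintegral_zero,
          mul_zero, zero_add]
        have hDω (i : ℕ) : Measurable fun m : ℕ → Bool × Fin M × ℝ × ℝ =>
            decodable noise ξ i (fun j => s.pos j ω) (m i) m := (hD i).comp measurable_prodMk_left
        rw [lintegral_tsum fun i => (hDω i).aemeasurable]
        have hdec (i : ℕ) := lintegral_decodable (noise := noise) (ξ := ξ) hM hρ₀ hρ₁ hν i
          (x := fun j => s.pos j ω) (hω i)
        simp_rw [hdec, ENNReal.tsum_mul_left]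
    _ = _ := by
        rw [lintegral_const_mul' _ _ ENNReal.ofReal_ne_top,
          lintegral_const_mul' _ _ ENNReal.ofReal_ne_top]

end HelloSlot

/-- The mean number of discovered nodes as a function of the effective density. -/
noncomputable def discoveryFunction (M : ℕ) (ρ ξ noise T : ℝ) : ℝ≥0∞ :=
  ENNReal.ofReal (ρ * (1 - ρ) * Real.pi) * ∫⁻ v in Set.Ioi (0 : ℝ),
    ENNReal.ofReal (Real.exp (-(noise * ξ * v ^ 2 / T ^ 2 + ρ / M * (Real.pi ^ 2 / 2) * √ξ * v)))

lemma effectiveDensity_pos {lam : ℝ} (hlam : 0 < lam) {ν : Measure ℝ} [IsProbabilityMeasure ν]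
    (hν : ∀ᵐ t ∂ν, 0 < t) (hint : Integrable (fun t : ℝ => t ^ ((2 : ℝ) / 4)) ν) :
    0 < effectiveDensity 4 lam ν := by
  refine mul_pos hlam ((integral_pos_iff_support_of_nonneg_ae
    (hν.mono fun t ht => Real.rpow_nonneg ht.le _) hint).2 ?_)
  have : Function.support (fun t : ℝ => t ^ ((2 : ℝ) / 4)) =ᵐ[ν] Set.univ :=
    eventuallyEq_univ.2 (hν.mono fun t ht => (Real.rpow_pos_of_pos ht _).ne')
  rw [measure_congr this, measure_univ]
  exact one_pos

/-- The contribution of the nodes with shadowing gain `t`. -/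
lemma lintegral_discovery {M : ℕ} (hM : 1 ≤ M) {ρ : ℝ} (hρ₀ : 0 ≤ ρ) {lam : ℝ} (hlam : 0 < lam)
    {ν : Measure ℝ} [IsProbabilityMeasure ν] (hν : ∀ᵐ t ∂ν, 0 < t)
    (hint : Integrable (fun t : ℝ => t ^ ((2 : ℝ) / 4)) ν) {noise ξ : ℝ} (hξ : 0 < ξ)
    (hn : 0 ≤ noise) {t : ℝ} (ht : 0 < t) :
    ∫⁻ x, expNeg (ENNReal.ofReal (ξ * ‖x‖ ^ 4 / t) * ENNReal.ofReal noise) *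
        expNeg (∫⁻ y, disturbance M ρ ν (ENNReal.ofReal (ξ * ‖x‖ ^ 4 / t)) y
          ∂(ENNReal.ofReal lam • (volume : Measure Plane)))
        ∂(ENNReal.ofReal lam • (volume : Measure Plane)) =
      ENNReal.ofReal (lam * Real.pi * (√t / effectiveDensity 4 lam ν)) *
        ∫⁻ v in Set.Ioi (0 : ℝ), ENNReal.ofReal (Real.exp (-(noise * ξ * v ^ 2 /
          effectiveDensity 4 lam ν ^ 2 + ρ / M * (Real.pi ^ 2 / 2) * √ξ * v))) := by
  have hT := effectiveDensity_pos hlam hν hint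
  set T := effectiveDensity 4 lam ν
  have hst : 0 < √t := Real.sqrt_pos.2 ht
  have hm : Measurable fun u : ℝ => ENNReal.ofReal (Real.exp (-(noise * (ξ * u ^ 2 / t) +
      T * (ρ / M * (Real.pi ^ 2 / 2)) * √(ξ * u ^ 2 / t)))) := by fun_prop
  have hx (x : Plane) : expNeg (ENNReal.ofReal (ξ * ‖x‖ ^ 4 / t) * ENNReal.ofReal noise) *
      expNeg (∫⁻ y, disturbance M ρ ν (ENNReal.ofReal (ξ * ‖x‖ ^ 4 / t)) y
        ∂(ENNReal.ofReal lam • (volume : Measure Plane))) =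
      ENNReal.ofReal (Real.exp (-(noise * (ξ * (‖x‖ ^ 2) ^ 2 / t) +
      T * (ρ / M * (Real.pi ^ 2 / 2)) * √(ξ * (‖x‖ ^ 2) ^ 2 / t)))) := by
    rw [lintegral_disturbance hν hint hM hρ₀ hlam.le (by positivity),
      ← ENNReal.ofReal_mul (by positivity), ← expNeg_add,
      ← ENNReal.ofReal_add (by positivity) (by positivity), expNeg_ofReal (by positivity),
      ← pow_mul, mul_comm noise]
  simp_rw [hx]
  -- Substitution `u = (√t/T) v`, chosen so that `T * √(ξu²/t) = √ξ v`; its Jacobian is the factor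
  -- `√t/T`.
  rw [lintegral_smul_measure, lintegral_norm_sq hm,
    lintegral_Ioi_comp_mul_left (show 0 < √t / T by positivity) hm, smul_eq_mul, ← mul_assoc,
    ← mul_assoc, ← ENNReal.ofReal_mul hlam.le, ← ENNReal.ofReal_mul (by positivity)]
  congr 1
  refine setLIntegral_congr_fun measurableSet_Ioi fun v hv => ?_
  have hv' : (0 : ℝ) < v := hv
  have h1 : ξ * (√t / T * v) ^ 2 / t = ξ * (v / T) ^ 2 := by
    rw [mul_pow, div_pow, Real.sq_sqrt ht.le]
    field_simp
  simp only [h1]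
  rw [Real.sqrt_mul hξ.le, Real.sqrt_sq (by positivity)]
  congr 3
  field_simp

namespace HelloSlot

variable {Ω : Type*} [MeasurableSpace Ω] {P : Measure Ω} {M : ℕ} {lam ρ : ℝ} {ν : Measure ℝ}
  [IsProbabilityMeasure ν]

lemma measurable_expNeg_mul_expNeg_logDisturbance (s : HelloSlot P M lam ρ ν) (c : ℝ≥0∞) (i : ℕ)
    {q : Ω × ℝ → ℝ≥0∞} (hq : Measurable q) : Measurable fun p : Ω × ℝ =>
      expNeg (q p * c) * expNeg (∑' j, if j = i then 0 else
        logDisturbance M ρ ν (q p) (s.pos j p.1)) := by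
  have hpos (j : ℕ) : Measurable fun p : Ω × ℝ => s.pos j p.1 :=
    (s.isPoisson.measurable j).comp measurable_fst
  have hf (j : ℕ) : Measurable fun p : Ω × ℝ =>
      if j = i then 0 else logDisturbance M ρ ν (q p) (s.pos j p.1) := by
    split_ifs
    · exact measurable_const
    · exact measurable_logDisturbance.comp (f := fun p => (q p, s.pos j p.1)) (hq.prodMk (hpos j))
  exact (measurable_expNeg.comp (hq.mul_const c)).mul (measurable_expNeg.comp (Measurable.tsum hf))

variable [IsProbabilityMeasure P]

/-- The mean number of discovered nodes depends on the density and on the shadowing only through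
the effective density. -/
theorem meanDiscovered_eq_discoveryFunction (s : HelloSlot P M lam ρ ν) (hM : 1 ≤ M) (hρ₀ : 0 < ρ)
    (hρ₁ : ρ < 1) (hlam : 0 < lam) (hν : ∀ᵐ t ∂ν, 0 < t)
    (hint : Integrable (fun t : ℝ => t ^ ((2 : ℝ) / 4)) ν) {noise ξ : ℝ} (hξ : 0 < ξ)
    (hn : 0 ≤ noise) :
    s.meanDiscovered 4 noise ξ = discoveryFunction M ρ ξ noise (effectiveDensity 4 lam ν) := by
  have hT := effectiveDensity_pos hlam hν hint
  have hG (i : ℕ) : Measurable fun p : Ω × ℝ =>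
      expNeg (ENNReal.ofReal (ξ * ‖s.pos i p.1‖ ^ 4 / p.2) * ENNReal.ofReal noise) *
        expNeg (∑' j, if j = i then 0 else logDisturbance M ρ ν
          (ENNReal.ofReal (ξ * ‖s.pos i p.1‖ ^ 4 / p.2)) (s.pos j p.1)) :=
    s.measurable_expNeg_mul_expNeg_logDisturbance _ i (Measurable.ennreal_ofReal
      (((((s.isPoisson.measurable i).comp measurable_fst).norm.pow_const 4).const_mul ξ).div
        measurable_snd))
  -- With the shadowing gain of the distinguished node held at `t`, its decoding parameter depends
  -- on its location alone, which is the form the Mecke formula handles.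
  have hmecke : ∀ t : ℝ, 0 < t → ∫⁻ ω, ∑' i,
      expNeg (ENNReal.ofReal (ξ * ‖s.pos i ω‖ ^ 4 / t) * ENNReal.ofReal noise) *
        expNeg (∑' j, if j = i then 0 else logDisturbance M ρ ν
          (ENNReal.ofReal (ξ * ‖s.pos i ω‖ ^ 4 / t)) (s.pos j ω)) ∂P =
      ENNReal.ofReal (lam * Real.pi * (√t / effectiveDensity 4 lam ν)) *
        ∫⁻ v in Set.Ioi (0 : ℝ), ENNReal.ofReal (Real.exp (-(noise * ξ * v ^ 2 /
          effectiveDensity 4 lam ν ^ 2 + ρ / M * (Real.pi ^ 2 / 2) * √ξ * v))) := by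
    intro t ht
    rw [← lintegral_discovery hM hρ₀.le hlam hν hint hξ hn ht]
    have hq : Measurable fun x : Plane => ENNReal.ofReal (ξ * ‖x‖ ^ 4 / t) := by fun_prop
    have h := s.isPoisson.lintegral_mecke (f := logDisturbance M ρ ν)
      (u := fun x => expNeg (ENNReal.ofReal (ξ * ‖x‖ ^ 4 / t) * ENNReal.ofReal noise))
      (measurable_expNeg.comp (hq.mul_const _)) (fun x => expNeg_le_one _)
      measurable_logDisturbance (logDisturbance_ne_top hM hρ₁) logDisturbance_mono
      (fun a x ha => logDisturbance_iSup ha x)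
      (q := fun x => ENNReal.ofReal (ξ * ‖x‖ ^ 4 / t)) hq
    simp_rw [one_sub_expNeg_logDisturbance hM hρ₁.le] at h
    exact h
  rw [s.meanDiscovered_eq_lintegral hM hρ₀.le hρ₁.le hν hξ]
  have hswap (ω : Ω) := lintegral_tsum (μ := ν) fun i =>
    ((hG i).comp (measurable_prodMk_left (x := ω))).aemeasurable
  simp only [Function.comp_def] at hswap
  simp_rw [← hswap]
  rw [lintegral_lintegral_swap (Measurable.tsum hG).aemeasurable,
    lintegral_congr_ae (hν.mono hmecke), lintegral_mul_const _ (by fun_prop), discoveryFunction,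
    ← mul_assoc, ← mul_assoc]
  congr 1
  have hsqrt (t : ℝ) : ENNReal.ofReal (lam * Real.pi * (√t / effectiveDensity 4 lam ν)) =
      ENNReal.ofReal (lam * Real.pi / effectiveDensity 4 lam ν) *
        ENNReal.ofReal (t ^ ((2 : ℝ) / 4)) := by
    rw [← ENNReal.ofReal_mul (by positivity), Real.sqrt_eq_rpow]
    congr 1
    norm_num
    ring
  simp_rw [hsqrt]
  rw [lintegral_const_mul' _ _ ENNReal.ofReal_ne_top, ← ofReal_integral_eq_lintegral_ofReal hint
    (hν.mono fun t ht => Real.rpow_nonneg ht.le _), ← ENNReal.ofReal_mul (sub_nonneg.2 hρ₁.le),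
    ← ENNReal.ofReal_mul (p := lam * Real.pi / effectiveDensity 4 lam ν) (by positivity),
    ← ENNReal.ofReal_mul (mul_nonneg (sub_nonneg.2 hρ₁.le) hρ₀.le)]
  congr 1
  -- Averaging the Jacobian over the shadowing reproduces the effective density and cancels it, so
  -- only the noise term still depends on it.
  have hI : lam * Real.pi / effectiveDensity 4 lam ν * ∫ t, t ^ ((2 : ℝ) / 4) ∂ν = Real.pi := by
    rw [div_mul_eq_mul_div, div_eq_iff hT.ne', effectiveDensity]
    ring
  rw [hI]
  ring

end HelloSlot

/-! ### Monotonicity and limit -/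

section DiscoveryFunction

variable {M : ℕ} {ρ ξ noise : ℝ}

/-- The integral is the reciprocal of the rate `(ρ/M)(π²/2)√ξ`. Its finiteness also serves as the
integrable bound for the noisy case. -/
lemma discoveryFunction_zero (hM : 1 ≤ M) (hρ₀ : 0 < ρ) (hρ₁ : ρ < 1) (hξ : 0 < ξ) (T : ℝ) :
    discoveryFunction M ρ ξ 0 T = ENNReal.ofReal (2 / Real.pi * (M * (1 - ρ) / √ξ)) := by
  have hMpos : (0 : ℝ) < M := by exact_mod_cast hM
  have hs : 0 < √ξ := Real.sqrt_pos.2 hξ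
  have hc : 0 < ρ / M * (Real.pi ^ 2 / 2) * √ξ := by positivity
  have h1 (v : ℝ) : -(0 * ξ * v ^ 2 / T ^ 2 + ρ / M * (Real.pi ^ 2 / 2) * √ξ * v) =
      -(ρ / M * (Real.pi ^ 2 / 2) * √ξ) * v := by ring
  simp_rw [discoveryFunction, h1]
  rw [← ofReal_integral_eq_lintegral_ofReal (integrableOn_exp_mul_Ioi (neg_neg_of_pos hc) 0)
    (.of_forall fun _ => (Real.exp_pos _).le), integral_exp_mul_Ioi (neg_neg_of_pos hc),
    ← ENNReal.ofReal_mul (mul_nonneg (mul_nonneg hρ₀.le (sub_nonneg.2 hρ₁.le)) Real.pi_pos.le),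
    mul_zero, Real.exp_zero, neg_div_neg_eq]
  congr 1
  field_simp

/-- Noise and effective density enter only through `noise / T²`. Varying both at once covers
monotonicity in `T` as well as, with `n₂ = 0`, the strict upper bound. -/
lemma discoveryFunction_lt (hM : 1 ≤ M) (hρ₀ : 0 < ρ) (hρ₁ : ρ < 1) (hξ : 0 < ξ)
    {n₁ n₂ T₁ T₂ : ℝ} (h : n₂ / T₂ ^ 2 < n₁ / T₁ ^ 2) (h₂ : 0 ≤ n₂) :
    discoveryFunction M ρ ξ n₁ T₁ < discoveryFunction M ρ ξ n₂ T₂ := by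
  have hfin := discoveryFunction_zero hM hρ₀ hρ₁ hξ 1
  have hpos : 0 < ρ * (1 - ρ) * Real.pi :=
    mul_pos (mul_pos hρ₀ (sub_pos.2 hρ₁)) Real.pi_pos
  have hlt (v : ℝ) (hv : 0 < v) : n₂ * ξ * v ^ 2 / T₂ ^ 2 < n₁ * ξ * v ^ 2 / T₁ ^ 2 := by
    have hc : 0 < ξ * v ^ 2 := by positivity
    calc n₂ * ξ * v ^ 2 / T₂ ^ 2 = n₂ / T₂ ^ 2 * (ξ * v ^ 2) := by ring
      _ < n₁ / T₁ ^ 2 * (ξ * v ^ 2) := mul_lt_mul_of_pos_right h hc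
      _ = n₁ * ξ * v ^ 2 / T₁ ^ 2 := by ring
  refine ENNReal.mul_lt_mul_right (ENNReal.ofReal_pos.2 hpos).ne' ENNReal.ofReal_ne_top ?_
  refine setLIntegral_strict_mono measurableSet_Ioi (by simp) (by fun_prop) ?_
    (.of_forall fun v hv => ?_)
  · refine ne_top_of_le_ne_top (b := ∫⁻ v in Set.Ioi (0 : ℝ), ENNReal.ofReal (Real.exp
      (-(0 * ξ * v ^ 2 / 1 ^ 2 + ρ / M * (Real.pi ^ 2 / 2) * √ξ * v)))) ?_ ?_
    · intro htop
      rw [discoveryFunction, htop, ENNReal.mul_top (ENNReal.ofReal_pos.2 hpos).ne'] at hfin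
      exact ENNReal.ofReal_ne_top hfin.symm
    · refine setLIntegral_mono (by fun_prop) fun v hv => ENNReal.ofReal_le_ofReal
        (Real.exp_le_exp.2 ?_)
      have h0 : 0 ≤ n₂ * ξ * v ^ 2 / T₂ ^ 2 := by positivity
      have := hlt v hv
      simp only [zero_mul, zero_div]
      linarith
  · refine (ENNReal.ofReal_lt_ofReal_iff (Real.exp_pos _)).2 (Real.exp_lt_exp.2 ?_)
    have := hlt v hv
    linarith

lemma strictMonoOn_discoveryFunction (hM : 1 ≤ M) (hρ₀ : 0 < ρ) (hρ₁ : ρ < 1) (hξ : 0 < ξ)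
    (hn : 0 < noise) : StrictMonoOn (discoveryFunction M ρ ξ noise) (Set.Ioi 0) := by
  intro a ha b hb hab
  have ha' : 0 < a := ha
  refine discoveryFunction_lt hM hρ₀ hρ₁ hξ ?_ hn.le
  gcongr

lemma discoveryFunction_lt_limit (hM : 1 ≤ M) (hρ₀ : 0 < ρ) (hρ₁ : ρ < 1) (hξ : 0 < ξ)
    (hn : 0 < noise) {T : ℝ} (hT : 0 < T) :
    discoveryFunction M ρ ξ noise T < ENNReal.ofReal (2 / Real.pi * (M * (1 - ρ) / √ξ)) := by
  rw [← discoveryFunction_zero hM hρ₀ hρ₁ hξ 1]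
  refine discoveryFunction_lt hM hρ₀ hρ₁ hξ ?_ le_rfl
  rw [zero_div]
  positivity

lemma tendsto_discoveryFunction (hM : 1 ≤ M) (hρ₀ : 0 < ρ) (hρ₁ : ρ < 1) (hξ : 0 < ξ)
    (hn : 0 ≤ noise) : Tendsto (discoveryFunction M ρ ξ noise) atTop
      (𝓝 (ENNReal.ofReal (2 / Real.pi * (M * (1 - ρ) / √ξ)))) := by
  have hfin := discoveryFunction_zero hM hρ₀ hρ₁ hξ 1
  have hpos : 0 < ρ * (1 - ρ) * Real.pi :=
    mul_pos (mul_pos hρ₀ (sub_pos.2 hρ₁)) Real.pi_pos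
  rw [← hfin]
  refine ENNReal.Tendsto.const_mul ?_ (.inr ENNReal.ofReal_ne_top)
  -- The noise-free integrand is both the dominating function and the pointwise limit.
  refine tendsto_lintegral_filter_of_dominated_convergence (fun v => ENNReal.ofReal (Real.exp
      (-(0 * ξ * v ^ 2 / 1 ^ 2 + ρ / M * (Real.pi ^ 2 / 2) * √ξ * v))))
    (.of_forall fun T => by fun_prop) (.of_forall fun T => .of_forall fun v => ?_) ?_
    (.of_forall fun v => ?_)
  · refine ENNReal.ofReal_le_ofReal (Real.exp_le_exp.2 ?_)
    have h0 : 0 ≤ noise * ξ * v ^ 2 / T ^ 2 := by positivity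
    simp only [zero_mul, zero_div]
    linarith
  · intro htop
    rw [discoveryFunction, htop, ENNReal.mul_top (ENNReal.ofReal_pos.2 hpos).ne'] at hfin
    exact ENNReal.ofReal_ne_top hfin.symm
  · refine ENNReal.tendsto_ofReal ((Real.continuous_exp.tendsto _).comp ?_)
    refine Tendsto.neg (Tendsto.add_const _ ?_)
    simp only [zero_mul, zero_div]
    exact tendsto_const_nhds.div_atTop (tendsto_pow_atTop two_ne_zero)

end DiscoveryFunction

end PeerDiscovery

theorem mainTheorem6 (M : ℕ) (hM : 1 ≤ M) (ρ : ℝ) (hρ₀ : 0 < ρ) (hρ₁ : ρ < 1)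
    (ξ : ℝ) (hξ : 0 < ξ) :
    -- the interference-limited case
    (∀ (lam : ℝ), 0 < lam →
      ∀ (ν : Measure ℝ) [IsProbabilityMeasure ν], (∀ᵐ t ∂ν, 0 < t) →
        Integrable (fun t : ℝ => t ^ ((2 : ℝ) / 4)) ν →
      ∀ {Ω : Type*} [MeasurableSpace Ω] (P : Measure Ω) [IsProbabilityMeasure P]
        (s : PeerDiscovery.HelloSlot P M lam ρ ν),
        s.meanDiscovered 4 0 ξ = ENNReal.ofReal (2 / Real.pi * (M * (1 - ρ) / √ξ))) ∧
    -- the case of a nonzero noise power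
    (∀ (noise : ℝ), 0 < noise →
      ∃ F : ℝ → ℝ≥0∞,
        StrictMonoOn F (Set.Ioi 0) ∧
        Tendsto F atTop (𝓝 (ENNReal.ofReal (2 / Real.pi * (M * (1 - ρ) / √ξ)))) ∧
        (∀ t, 0 < t → F t < ENNReal.ofReal (2 / Real.pi * (M * (1 - ρ) / √ξ))) ∧
        ∀ (lam : ℝ), 0 < lam →
          ∀ (ν : Measure ℝ) [IsProbabilityMeasure ν], (∀ᵐ t ∂ν, 0 < t) →
            Integrable (fun t : ℝ => t ^ ((2 : ℝ) / 4)) ν →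
          ∀ {Ω : Type*} [MeasurableSpace Ω] (P : Measure Ω) [IsProbabilityMeasure P]
            (s : PeerDiscovery.HelloSlot P M lam ρ ν),
            s.meanDiscovered 4 noise ξ = F (PeerDiscovery.effectiveDensity 4 lam ν)) := by
  refine ⟨fun lam hlam ν _ hν hint Ω _ P _ s => ?_, fun noise hn =>
    ⟨PeerDiscovery.discoveryFunction M ρ ξ noise,
      PeerDiscovery.strictMonoOn_discoveryFunction hM hρ₀ hρ₁ hξ hn,
      PeerDiscovery.tendsto_discoveryFunction hM hρ₀ hρ₁ hξ hn.le,
      fun t ht => PeerDiscovery.discoveryFunction_lt_limit hM hρ₀ hρ₁ hξ hn ht,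
      fun lam hlam ν _ hν hint Ω _ P _ s =>
        s.meanDiscovered_eq_discoveryFunction hM hρ₀ hρ₁ hlam hν hint hξ hn.le⟩⟩
  rw [s.meanDiscovered_eq_discoveryFunction hM hρ₀ hρ₁ hlam hν hint hξ le_rfl,
    PeerDiscovery.discoveryFunction_zero hM hρ₀ hρ₁ hξ]
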